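/- THEOREM. Let $\zeta$ be the Riemann zeta-function, let $$\chi(s) = 2^s\pi^{s-1}\sin\left(\tfrac12\pi s\right)\Gamma(1-s),$$ so that $\zeta(s)=\chi(s)\zeta(1-s)$, and let $$Z(t) = \chi^{-1/2}\left(\tfrac12+it\right)\zeta\left(\tfrac12+it\right)\qquad(t\in\mathbb R)$$ be Hardy's function, where $t\mapsto\chi^{-1/2}(\frac12+it)$ denotes the continuous branch on $\mathbb R$ with value $1$ at $t=0$ (note that $\chi(\frac12)=1$); the function $Z$ is real-valued. Then, for every $\varepsilon>0$, $$\int_0^T Z(t)\,dt = O_\varepsilon\left(T^{1/4+\varepsilon}\right)\qquad(T\to\infty),$$ where the implied constant depends only on $\varepsilon$. -/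

import Mathlib

/-- The factor `χ(s) = 2^s π^(s-1) sin(πs/2) Γ(1-s)` of the functional equation
`ζ(s) = χ(s) ζ(1-s)`. -/
noncomputable def zetaChi (s : ℂ) : ℂ :=
  2 ^ s * (Real.pi : ℂ) ^ (s - 1) * Complex.sin (Real.pi * s / 2) * Complex.Gamma (1 - s)

/-- The point `1/2 + it` of the critical line. -/
noncomputable def critPt (t : ℝ) : ℂ := 1 / 2 + (t : ℂ) * Complex.I

theorem critPt_re (t : ℝ) : (critPt t).re = 1 / 2 := by simp [critPt]

theorem critPt_conj (t : ℝ) : (starRingEnd ℂ) (critPt t) = 1 - critPt t := by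
  simp only [critPt, map_add, map_mul, map_div₀, map_one, Complex.conj_ofReal, Complex.conj_I,
    Complex.conj_ofNat]
  ring

theorem continuous_critPt : Continuous critPt := by
  unfold critPt
  fun_prop

theorem critPt_ne_neg_nat (t : ℝ) (n : ℕ) : critPt t ≠ -n := by
  intro h
  have h1 := congrArg Complex.re h
  rw [critPt_re] at h1
  simp only [Complex.neg_re, Complex.natCast_re] at h1
  have : (0 : ℝ) ≤ n := n.cast_nonneg
  linarith

theorem critPt_ne_one (t : ℝ) : critPt t ≠ 1 := by
  intro h
  have h1 := congrArg Complex.re h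
  rw [critPt_re] at h1
  norm_num at h1

theorem one_sub_critPt (t : ℝ) : 1 - critPt t = critPt (-t) := by
  simp only [critPt, Complex.ofReal_neg]
  ring

theorem riemannZeta_critPt (t : ℝ) :
    riemannZeta (critPt t) = zetaChi (critPt t) * riemannZeta (1 - critPt t) := by
  have h := riemannZeta_one_sub (s := critPt (-t)) (critPt_ne_neg_nat (-t)) (critPt_ne_one (-t))
  rw [← one_sub_critPt, sub_sub_cancel] at h
  rw [h, zetaChi]
  congr 1
  have hcos : Complex.cos (Real.pi * (1 - critPt t) / 2)
      = Complex.sin (Real.pi * critPt t / 2) := by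
    rw [← Complex.cos_pi_div_two_sub]
    congr 1
    ring
  have hpow : (2 * (Real.pi : ℂ)) ^ (critPt t - 1)
      = 2 ^ (critPt t - 1) * (Real.pi : ℂ) ^ (critPt t - 1) := by
    have := Complex.mul_cpow_ofReal_nonneg (a := 2) (b := Real.pi) (by norm_num)
      Real.pi_pos.le (critPt t - 1)
    simpa using this
  have h2 : (2 : ℂ) ^ critPt t = 2 * 2 ^ (critPt t - 1) := by
    rw [Complex.cpow_sub _ _ two_ne_zero, Complex.cpow_one]
    field_simp
  rw [hcos, neg_sub, hpow, h2]
  ring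

theorem zetaChi_critPt (t : ℝ) :
    zetaChi (critPt t) = Complex.Gammaℝ (1 - critPt t) / Complex.Gammaℝ (critPt t) := by
  have hs : ∀ n : ℕ, (1 - critPt t) ≠ -(2 * n + 1) := by
    intro n
    rw [one_sub_critPt]
    have := critPt_ne_neg_nat (-t) (2 * n + 1)
    push_cast at this
    exact this
  have h := Complex.Gammaℝ_div_Gammaℝ_one_sub hs
  rw [sub_sub_cancel] at h
  rw [h, zetaChi, Complex.Gammaℂ_def]
  have hcos : Complex.cos (Real.pi * (1 - critPt t) / 2)
      = Complex.sin (Real.pi * critPt t / 2) := by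
    rw [← Complex.cos_pi_div_two_sub]
    congr 1
    ring
  have hpow : (2 * (Real.pi : ℂ)) ^ (critPt t - 1)
      = 2 ^ (critPt t - 1) * (Real.pi : ℂ) ^ (critPt t - 1) := by
    have := Complex.mul_cpow_ofReal_nonneg (a := 2) (b := Real.pi) (by norm_num)
      Real.pi_pos.le (critPt t - 1)
    simpa using this
  have h2 : (2 : ℂ) ^ critPt t = 2 * 2 ^ (critPt t - 1) := by
    rw [Complex.cpow_sub _ _ two_ne_zero, Complex.cpow_one]
    field_simp
  rw [hcos, neg_sub, hpow, h2]
  ring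

theorem Gammaℝ_conj (s : ℂ) :
    Complex.Gammaℝ ((starRingEnd ℂ) s) = (starRingEnd ℂ) (Complex.Gammaℝ s) := by
  have harg : ((Real.pi : ℝ) : ℂ).arg ≠ Real.pi := by
    rw [Complex.arg_ofReal_of_nonneg Real.pi_pos.le]
    exact Real.pi_pos.ne
  have h1 : -((starRingEnd ℂ) s) / 2 = (starRingEnd ℂ) (-s / 2) := by
    simp only [map_div₀, map_neg, Complex.conj_ofNat]
  have h2 : (starRingEnd ℂ) s / 2 = (starRingEnd ℂ) (s / 2) := by
    simp only [map_div₀, Complex.conj_ofNat]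
  rw [Complex.Gammaℝ_def, Complex.Gammaℝ_def, h1, h2, Complex.cpow_conj _ _ harg,
    Complex.Gamma_conj, Complex.conj_ofReal, map_mul]

theorem Gammaℝ_critPt_ne_zero (t : ℝ) : Complex.Gammaℝ (critPt t) ≠ 0 :=
  Complex.Gammaℝ_ne_zero_of_re_pos (by rw [critPt_re]; norm_num)

theorem continuous_Gammaℝ_critPt : Continuous fun t : ℝ => Complex.Gammaℝ (critPt t) := by
  have h : Continuous fun t : ℝ => ((Complex.Gammaℝ (critPt t))⁻¹)⁻¹ :=
    (Complex.differentiable_Gammaℝ_inv.continuous.comp continuous_critPt).inv₀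
      (fun t => inv_ne_zero (Gammaℝ_critPt_ne_zero t))
  simpa using h

/-- `w` is the branch of `t ↦ χ(1/2+it)^(-1/2)` that is continuous on the real line and has the
value `1` at `t = 0` (note `χ(1/2) = 1`). -/
def IsChiInvSqrt (w : ℝ → ℂ) : Prop :=
  Continuous w ∧ w 0 = 1 ∧ ∀ t : ℝ, w t ^ 2 * zetaChi (critPt t) = 1

theorem isChiInvSqrt_Gammaℝ :
    IsChiInvSqrt fun t => Complex.Gammaℝ (critPt t) / (‖Complex.Gammaℝ (critPt t)‖ : ℂ) := by
  refine ⟨?_, ?_, fun t => ?_⟩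
  · refine continuous_Gammaℝ_critPt.div
      (Complex.continuous_ofReal.comp continuous_Gammaℝ_critPt.norm) fun t => ?_
    simpa using Gammaℝ_critPt_ne_zero t
  · have hpos : ∃ r : ℝ, 0 < r ∧ Complex.Gammaℝ (critPt 0) = (r : ℂ) := by
      refine ⟨Real.pi ^ (-(1 / 4) : ℝ) * Real.Gamma (1 / 4), by positivity, ?_⟩
      rw [Complex.Gammaℝ_def, Complex.ofReal_mul, Complex.ofReal_cpow Real.pi_pos.le,
        ← Complex.Gamma_ofReal]
      have h1 : -critPt 0 / 2 = ((-(1 / 4) : ℝ) : ℂ) := by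
        simp only [critPt]; push_cast; ring
      have h2 : critPt 0 / 2 = ((1 / 4 : ℝ) : ℂ) := by
        simp only [critPt]; push_cast; ring
      rw [h1, h2]
    obtain ⟨r, hr, h⟩ := hpos
    simp only [h, Complex.norm_real, Real.norm_of_nonneg hr.le]
    exact div_self (by exact_mod_cast hr.ne')
  · have h0 := Gammaℝ_critPt_ne_zero t
    have hn : (‖Complex.Gammaℝ (critPt t)‖ : ℂ) ≠ 0 := by simpa using h0
    have hc := Complex.mul_conj' (Complex.Gammaℝ (critPt t))
    rw [zetaChi_critPt, ← critPt_conj, Gammaℝ_conj]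
    field_simp
    rw [hc]

theorem IsChiInvSqrt.unique {v w : ℝ → ℂ} (hv : IsChiInvSqrt v) (hw : IsChiInvSqrt w) :
    v = w := by
  have hne : ∀ t : ℝ, w t ≠ 0 := by
    intro t h
    have := hw.2.2 t
    simp [h] at this
  have hsq : Set.EqOn (v ^ 2) (w ^ 2) Set.univ := by
    intro t _
    have h1 := hv.2.2 t
    have hχ : zetaChi (critPt t) ≠ 0 := right_ne_zero_of_mul (h1 ▸ one_ne_zero)
    exact mul_right_cancel₀ hχ (h1.trans (hw.2.2 t).symm)
  funext t
  exact isPreconnected_univ.eq_of_sq_eq hv.1.continuousOn hw.1.continuousOn hsq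
    (fun {t} _ => hne t) (Set.mem_univ (0 : ℝ)) (hv.2.1.trans hw.2.1.symm) (Set.mem_univ t)

theorem existsUnique_isChiInvSqrt : ∃! w : ℝ → ℂ, IsChiInvSqrt w :=
  ⟨_, isChiInvSqrt_Gammaℝ, fun _ h => h.unique isChiInvSqrt_Gammaℝ⟩

/-- `t ↦ χ(1/2+it)^(-1/2)`: the unique continuous branch with value `1` at `t = 0`. -/
noncomputable def chiInvSqrt : ℝ → ℂ := existsUnique_isChiInvSqrt.choose

theorem isChiInvSqrt_chiInvSqrt : IsChiInvSqrt chiInvSqrt :=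
  existsUnique_isChiInvSqrt.choose_spec.1

theorem chiInvSqrt_eq (t : ℝ) :
    chiInvSqrt t = Complex.Gammaℝ (critPt t) / (‖Complex.Gammaℝ (critPt t)‖ : ℂ) :=
  congrFun (isChiInvSqrt_chiInvSqrt.unique isChiInvSqrt_Gammaℝ) t

/-- Hardy's function `Z(t) = χ(1/2+it)^(-1/2) ζ(1/2+it)`, as a real number; the product is real
by `ofReal_hardyZ` below. -/
noncomputable def hardyZ (t : ℝ) : ℝ := (chiInvSqrt t * riemannZeta (critPt t)).re

theorem ofReal_hardyZ (t : ℝ) : (hardyZ t : ℂ) = chiInvSqrt t * riemannZeta (critPt t) := by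
  refine Complex.conj_eq_iff_re.mp ?_
  have hw := isChiInvSqrt_chiInvSqrt.2.2 t
  have h0 : chiInvSqrt t ≠ 0 := by
    intro h
    simp [h] at hw
  have hnorm : ‖chiInvSqrt t‖ = 1 := by
    rw [chiInvSqrt_eq, norm_div, Complex.norm_real, norm_norm]
    exact div_self (norm_ne_zero_iff.mpr (Gammaℝ_critPt_ne_zero t))
  have hc : chiInvSqrt t * (starRingEnd ℂ) (chiInvSqrt t) = 1 := by
    rw [Complex.mul_conj', hnorm]
    norm_num
  rw [map_mul, ← riemannZeta_conj, critPt_conj, riemannZeta_critPt t]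
  apply mul_left_cancel₀ h0
  rw [← mul_assoc, hc]
  linear_combination (-riemannZeta (1 - critPt t)) * hw

theorem continuous_hardyZ : Continuous hardyZ := by
  refine Complex.continuous_re.comp (isChiInvSqrt_chiInvSqrt.1.mul ?_)
  refine continuous_iff_continuousAt.mpr fun t => ?_
  exact ContinuousAt.comp (f := critPt)
    (differentiableAt_riemannZeta (critPt_ne_one t)).continuousAt continuous_critPt.continuousAt

/-! Put `s = 2z`, `z = 1/4 + iy`. Since `Z` is the completed zeta function divided by `|Gammaℝ|`,
`Z(2y)` equals a constant times `rotatedZeta z` times the positive weight `e^{-πy/2} / |Γ(1/4+iy)|`,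
which has order `y^{1/4}`. This weight is a product of one decreasing bounded factor and one
increasing factor (`hardyZ_two_mul`), so two partial integrations reduce the theorem to `∫_1^Y
rotatedZeta (1/4+iy) dy = O(Y^{2η})`: the whole power `T^{1/4}` comes from the weight, and the zeta
integral contributes only `T^ε`.

To bound that integral, the line is moved to `Re z = 1/2 + η`. The horizontal edges cost `O(Y^η)` by
the convexity bound `exists_norm_rotatedZeta_le`. On the new line the Dirichlet series converges
absolutely and can be integrated term by term, with terms `Γ(z) e^{-iπz/2} a^{-z}`, `a = πn²`. By
Mellin inversion on a ray rotated towards the imaginary axis, the full vertical integral of such a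
term tends to `2π e^{-ia} = 2π (-1)^n`. The oscillation is stationary only at `y = a`, so with `Y =
πX²` the integral up to `Y` is `2π (-1)^n` plus a small error when `n < X`, and is small when `n >
X`. The main terms form an alternating sum, which is bounded. The errors, of size about `Y^η
n^{-1-2η} max(X,n)/|X-n|`, add up to `O(Y^{2η})`, and the two values of `n` nearest to `X`
contribute `O(1)`.

No asymptotic formula for the argument of `Γ` is needed. Its modulus is controlled by log-convexity
and the exact value on `Re z = 1/2`. Oscillation is captured by the recurrence
`saddleKernel_add_one`: away from the saddle point the kernel is a unit difference of a holomorphic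
function, up to a small remainder, and Cauchy's theorem turns the integral of a unit difference into
two short horizontal edges. -/

/-! ### The modulus of the Gamma function on vertical lines. -/

/-- The function `log |x+iy|` alone is convex for `x < |y|`; adding `log x` contributes `-1/x²` to
the second derivative, which dominates `(y²-x²)/(x²+y²)²`. -/
theorem concaveOn_log_add_log_norm (y : ℝ) :
    ConcaveOn ℝ (Set.Ioi 0) fun x : ℝ => Real.log x + Real.log ‖(x : ℂ) + y * Complex.I‖ := by
  have hF : ∀ x ∈ Set.Ioi (0 : ℝ), Real.log x + Real.log ‖(x : ℂ) + y * Complex.I‖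
      = Real.log x + Real.log (x ^ 2 + y ^ 2) / 2 := by
    intro x _
    rw [Complex.norm_add_mul_I, Real.log_sqrt (by positivity)]
  refine ConcaveOn.congr ?_ fun x hx => (hF x hx).symm
  have hd : ∀ x ∈ Set.Ioi (0 : ℝ), HasDerivAt
      (fun x : ℝ => Real.log x + Real.log (x ^ 2 + y ^ 2) / 2) (x⁻¹ + x / (x ^ 2 + y ^ 2)) x := by
    intro x hx
    have hx0 : (0 : ℝ) < x := hx
    have hq : x ^ 2 + y ^ 2 ≠ 0 := by positivity
    have h := (Real.hasDerivAt_log hx0.ne').add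
      ((((hasDerivAt_pow 2 x).add_const (y ^ 2)).log hq).div_const 2)
    refine h.congr_deriv ?_
    simp only [Nat.cast_ofNat]
    field_simp
    ring
  have hd2 : ∀ x ∈ Set.Ioi (0 : ℝ), HasDerivAt
      (fun x : ℝ => x⁻¹ + x / (x ^ 2 + y ^ 2))
      (-(x ^ 2)⁻¹ + (x ^ 2 + y ^ 2 - x * (2 * x)) / (x ^ 2 + y ^ 2) ^ 2) x := by
    intro x hx
    have hx0 : (0 : ℝ) < x := hx
    have hq : x ^ 2 + y ^ 2 ≠ 0 := by positivity
    have h := (hasDerivAt_inv hx0.ne').add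
      ((hasDerivAt_id x).div ((hasDerivAt_pow 2 x).add_const (y ^ 2)) hq)
    refine h.congr_deriv ?_
    simp
  refine concaveOn_of_hasDerivWithinAt2_nonpos (convex_Ioi 0)
    (f' := fun x : ℝ => x⁻¹ + x / (x ^ 2 + y ^ 2))
    (f'' := fun x : ℝ => -(x ^ 2)⁻¹ + (x ^ 2 + y ^ 2 - x * (2 * x)) / (x ^ 2 + y ^ 2) ^ 2)
    (fun x hx => (hd x hx).continuousAt.continuousWithinAt) ?_ ?_ ?_
  · rw [interior_Ioi]
    exact fun x hx => (hd x hx).hasDerivWithinAt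
  · rw [interior_Ioi]
    exact fun x hx => (hd2 x hx).hasDerivWithinAt
  · rw [interior_Ioi]
    intro x hx
    have hx0 : (0 : ℝ) < x := hx
    have hq : 0 < x ^ 2 + y ^ 2 := by positivity
    have : (x ^ 2 + y ^ 2 - x * (2 * x)) / (x ^ 2 + y ^ 2) ^ 2 ≤ (x ^ 2)⁻¹ := by
      rw [div_le_iff₀ (by positivity), inv_mul_eq_div, le_div_iff₀ (by positivity)]
      nlinarith [sq_nonneg (x ^ 2), sq_nonneg (x * y), sq_nonneg (y ^ 2)]
    linarith

theorem norm_Complex_GammaSeq {x : ℝ} (y : ℝ) {n : ℕ} (hn : 0 < n) :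
    ‖Complex.GammaSeq (x + y * Complex.I) n‖
      = (n : ℝ) ^ x * n.factorial
        / ∏ j ∈ Finset.range (n + 1), ‖((x + j : ℝ) : ℂ) + y * Complex.I‖ := by
  rw [Complex.GammaSeq, norm_div, norm_mul, norm_prod, Complex.norm_natCast,
    Complex.norm_natCast_cpow_of_pos hn]
  congr 1
  · simp
  · refine Finset.prod_congr rfl fun j _ => ?_
    congr 1
    push_cast
    ring

theorem norm_ofReal_add_mul_I_pos {x : ℝ} (hx : 0 < x) (y : ℝ) :
    0 < ‖(x : ℂ) + y * Complex.I‖ := by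
  rw [norm_pos_iff]
  intro h
  have := congrArg Complex.re h
  simp at this
  exact hx.ne' this

theorem log_norm_GammaSeq_mul_GammaSeq {x : ℝ} (hx : 0 < x) (y : ℝ) {n : ℕ} (hn : 0 < n) :
    Real.log (‖Complex.GammaSeq (x + y * Complex.I) n‖ * Real.GammaSeq x n)
      = 2 * x * Real.log n + 2 * Real.log n.factorial
        - ∑ j ∈ Finset.range (n + 1),
          (Real.log (x + j) + Real.log ‖((x + j : ℝ) : ℂ) + y * Complex.I‖) := by
  have hn' : (0 : ℝ) < n := by exact_mod_cast hn
  have hf : (n.factorial : ℝ) ≠ 0 := by positivity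
  have h1 : ∀ j ∈ Finset.range (n + 1), ‖((x + j : ℝ) : ℂ) + y * Complex.I‖ ≠ 0 :=
    fun j _ => (norm_ofReal_add_mul_I_pos (by positivity) y).ne'
  have h2 : ∀ j ∈ Finset.range (n + 1), x + (j : ℝ) ≠ 0 := fun j _ => by positivity
  have hp : (n : ℝ) ^ x ≠ 0 := (Real.rpow_pos_of_pos hn' x).ne'
  have h1' := Finset.prod_ne_zero_iff.mpr h1
  have h2' := Finset.prod_ne_zero_iff.mpr h2
  rw [norm_Complex_GammaSeq y hn, Real.GammaSeq, Finset.sum_add_distrib,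
    Real.log_mul (div_ne_zero (mul_ne_zero hp hf) h1') (div_ne_zero (mul_ne_zero hp hf) h2'),
    Real.log_div (mul_ne_zero hp hf) h1', Real.log_div (mul_ne_zero hp hf) h2',
    Real.log_mul hp hf, Real.log_rpow hn', Real.log_prod h1, Real.log_prod h2]
  ring

/-- `x ↦ |Γ(x+iy)| Γ(x)` is log-convex on the positive reals. -/
theorem norm_Gamma_mul_Gamma_le {a b p q : ℝ} (y : ℝ) (ha : 0 < a) (hb : 0 < b) (hp : 0 ≤ p)
    (hq : 0 ≤ q) (hpq : p + q = 1) :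
    ‖Complex.Gamma ((p * a + q * b : ℝ) + y * Complex.I)‖ * Real.Gamma (p * a + q * b)
      ≤ (‖Complex.Gamma (a + y * Complex.I)‖ * Real.Gamma a) ^ p
        * (‖Complex.Gamma (b + y * Complex.I)‖ * Real.Gamma b) ^ q := by
  have hlim : ∀ x : ℝ, Filter.Tendsto
      (fun n => ‖Complex.GammaSeq (x + y * Complex.I) n‖ * Real.GammaSeq x n) Filter.atTop
      (nhds (‖Complex.Gamma (x + y * Complex.I)‖ * Real.Gamma x)) := fun x =>
    (Complex.GammaSeq_tendsto_Gamma _).norm.mul (Real.GammaSeq_tendsto_Gamma x)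
  have hc : 0 < p * a + q * b := by
    rcases hp.eq_or_lt with h | h
    · have : q = 1 := by linarith
      subst h; subst this; simpa using hb
    · have := mul_pos h ha
      have := mul_nonneg hq hb.le
      linarith
  refine le_of_tendsto_of_tendsto (hlim _)
    (((hlim a).rpow_const (Or.inr hp)).mul ((hlim b).rpow_const (Or.inr hq))) ?_
  filter_upwards [Filter.eventually_gt_atTop 0] with n hn
  have hn' : (0 : ℝ) < n := by exact_mod_cast hn
  have hpos : ∀ x : ℝ, 0 < x →
      0 < ‖Complex.GammaSeq (x + y * Complex.I) n‖ * Real.GammaSeq x n := by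
    intro x hx
    rw [norm_Complex_GammaSeq y hn, Real.GammaSeq]
    have h1 : 0 < ∏ j ∈ Finset.range (n + 1), ‖((x + j : ℝ) : ℂ) + y * Complex.I‖ :=
      Finset.prod_pos fun j _ => norm_ofReal_add_mul_I_pos (by positivity) y
    have h2 : 0 < ∏ j ∈ Finset.range (n + 1), (x + (j : ℝ)) :=
      Finset.prod_pos fun j _ => by positivity
    positivity
  rw [← Real.log_le_log_iff (hpos _ hc)
    (mul_pos (Real.rpow_pos_of_pos (hpos a ha) p) (Real.rpow_pos_of_pos (hpos b hb) q)),
    Real.log_mul (Real.rpow_pos_of_pos (hpos a ha) p).ne'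
      (Real.rpow_pos_of_pos (hpos b hb) q).ne', Real.log_rpow (hpos a ha),
    Real.log_rpow (hpos b hb), log_norm_GammaSeq_mul_GammaSeq hc y hn,
    log_norm_GammaSeq_mul_GammaSeq ha y hn, log_norm_GammaSeq_mul_GammaSeq hb y hn]
  -- In Euler's product the remaining terms are affine in `x` and cancel in the convex combination,
  -- so concavity of each factor's logarithm is all that is needed.
  have hsum : ∑ j ∈ Finset.range (n + 1),
        (p * (Real.log (a + j) + Real.log ‖((a + j : ℝ) : ℂ) + y * Complex.I‖)
          + q * (Real.log (b + j) + Real.log ‖((b + j : ℝ) : ℂ) + y * Complex.I‖))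
      ≤ ∑ j ∈ Finset.range (n + 1), (Real.log (p * a + q * b + j)
          + Real.log ‖((p * a + q * b + j : ℝ) : ℂ) + y * Complex.I‖) := by
    refine Finset.sum_le_sum fun j _ => ?_
    have h := (concaveOn_log_add_log_norm y).2 (x := a + j) (y := b + j)
      (by simp only [Set.mem_Ioi]; positivity) (by simp only [Set.mem_Ioi]; positivity) hp hq hpq
    have he : p * (a + j) + q * (b + j) = p * a + q * b + j := by
      linear_combination (j : ℝ) * hpq
    simpa only [smul_eq_mul, he] using h
  rw [Finset.sum_add_distrib, ← Finset.mul_sum, ← Finset.mul_sum] at hsum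
  linear_combination hsum + 2 * Real.log n.factorial * (hpq).symm

/-- On `Re s = 1/2` one has `1 - s = conj s`, so the reflection formula gives the modulus exactly.
-/
theorem norm_Gamma_half_sq (y : ℝ) :
    ‖Complex.Gamma ((1 / 2 : ℝ) + y * Complex.I)‖ ^ 2 = Real.pi / Real.cosh (Real.pi * y) := by
  have h := Complex.Gamma_mul_Gamma_one_sub ((1 / 2 : ℝ) + y * Complex.I)
  have hc : 1 - ((1 / 2 : ℝ) + y * Complex.I) = (starRingEnd ℂ) ((1 / 2 : ℝ) + y * Complex.I) := by
    rw [map_add, map_mul, Complex.conj_ofReal, Complex.conj_ofReal, Complex.conj_I]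
    push_cast
    ring
  have hs : Complex.sin (Real.pi * ((1 / 2 : ℝ) + y * Complex.I))
      = (Real.cosh (Real.pi * y) : ℂ) := by
    rw [Complex.ofReal_cosh, ← Complex.cos_mul_I, ← Complex.cos_pi_div_two_sub,
      ← Complex.cos_neg]
    congr 1
    push_cast
    ring
  rw [hc, Complex.Gamma_conj, Complex.mul_conj', hs] at h
  exact_mod_cast h

theorem norm_Gamma_half_le (y : ℝ) :
    ‖Complex.Gamma ((1 / 2 : ℝ) + y * Complex.I)‖ ≤ 3 * Real.exp (-(Real.pi / 2 * |y|)) := by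
  refine le_of_sq_le_sq ?_ (by positivity)
  rw [norm_Gamma_half_sq, mul_pow, ← Real.exp_nat_mul]
  have h1 : Real.exp (Real.pi * |y|) / 2 ≤ Real.cosh (Real.pi * y) := by
    rw [← Real.cosh_abs, abs_mul, abs_of_pos Real.pi_pos, Real.cosh_eq]
    have := Real.exp_pos (-(Real.pi * |y|))
    linarith
  have h2 : (((2 : ℕ) : ℝ) * -(Real.pi / 2 * |y|)) = -(Real.pi * |y|) := by push_cast; ring
  rw [h2, div_le_iff₀ (Real.cosh_pos _), Real.exp_neg]
  have h3 := Real.exp_pos (Real.pi * |y|)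
  have h4 := Real.pi_lt_four
  calc Real.pi ≤ 3 ^ 2 * (Real.exp (Real.pi * |y|))⁻¹ * (Real.exp (Real.pi * |y|) / 2) := by
        field_simp
        linarith
    _ ≤ _ := by gcongr

/-- Log-convexity interpolates between `Re = 1/2`, where the modulus is known, and `Re = 3/2`, where
the recurrence costs a factor `|1/2+iy| ≤ 1+|y|`. The weight of the right endpoint is `x - 1/2`,
hence the exponent. The real Gamma factors lie between positive constants. -/
theorem exists_norm_Gamma_le_of_mem_Icc :
    ∃ C : ℝ, 0 < C ∧ ∀ x ∈ Set.Icc (1 / 2 : ℝ) (3 / 2), ∀ y : ℝ,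
      ‖Complex.Gamma (x + y * Complex.I)‖
        ≤ C * (1 + |y|) ^ (x - 1 / 2) * Real.exp (-(Real.pi / 2 * |y|)) := by
  have hcont : ContinuousOn Real.Gamma (Set.Icc (1 / 2 : ℝ) (3 / 2)) := fun x hx =>
    (Real.differentiableOn_Gamma_Ioi.differentiableAt (Ioi_mem_nhds
      (show (0 : ℝ) < x by linarith [hx.1]))).continuousAt.continuousWithinAt
  obtain ⟨x₀, hx₀, hmin⟩ := isCompact_Icc.exists_isMinOn
    (Set.nonempty_Icc.mpr (by norm_num)) hcont
  set c := Real.Gamma x₀ with hc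
  have hcpos : 0 < c := Real.Gamma_pos_of_pos (by linarith [hx₀.1])
  set G := max (Real.Gamma (1 / 2)) (Real.Gamma (3 / 2)) with hG
  have hGpos : 0 < G := lt_max_of_lt_left (Real.Gamma_pos_of_pos (by norm_num))
  refine ⟨3 * G / c, by positivity, fun x hx y => ?_⟩
  set p := 3 / 2 - x with hp
  set q := x - 1 / 2 with hq
  have hp0 : 0 ≤ p := by linarith [hx.2]
  have hq0 : 0 ≤ q := by linarith [hx.1]
  have h := norm_Gamma_mul_Gamma_le (a := 1 / 2) (b := 3 / 2) y (by norm_num) (by norm_num) hp0 hq0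
    (by rw [hp, hq]; ring)
  have hx' : p * (1 / 2) + q * (3 / 2) = x := by rw [hp, hq]; ring
  rw [hx'] at h
  set g := ‖Complex.Gamma ((1 / 2 : ℝ) + y * Complex.I)‖ with hg
  have hstep : ‖Complex.Gamma ((3 / 2 : ℝ) + y * Complex.I)‖ ≤ (1 + |y|) * g := by
    have he : ((3 / 2 : ℝ) : ℂ) + y * Complex.I = ((1 / 2 : ℝ) + y * Complex.I) + 1 := by
      push_cast; ring
    have hne : ((1 / 2 : ℝ) + y * Complex.I : ℂ) ≠ 0 :=
      norm_pos_iff.mp (norm_ofReal_add_mul_I_pos (by norm_num) y)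
    rw [he, Complex.Gamma_add_one _ hne, norm_mul]
    gcongr
    refine (norm_add_le _ _).trans ?_
    rw [Complex.norm_real, norm_mul, Complex.norm_real, Complex.norm_I, mul_one,
      Real.norm_eq_abs, Real.norm_eq_abs]
    gcongr
    norm_num [abs_of_pos]
  have hg0 : 0 ≤ g := norm_nonneg _
  have hΓ1 : 0 ≤ Real.Gamma (1 / 2) := (Real.Gamma_pos_of_pos (by norm_num)).le
  have hΓ3 : 0 ≤ Real.Gamma (3 / 2) := (Real.Gamma_pos_of_pos (by norm_num)).le
  have h1 : (g * Real.Gamma (1 / 2)) ^ p * (‖Complex.Gamma ((3 / 2 : ℝ) + y * Complex.I)‖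
      * Real.Gamma (3 / 2)) ^ q ≤ (g * G) ^ p * (((1 + |y|) * g) * G) ^ q := by
    gcongr
    · exact le_max_left _ _
    · exact le_max_right _ _
  have hgG : 0 ≤ g * G := by positivity
  have h2 : (g * G) ^ p * (((1 + |y|) * g) * G) ^ q = (1 + |y|) ^ q * (g * G) := by
    rw [mul_assoc, Real.mul_rpow (by positivity) hgG, mul_left_comm,
      ← Real.rpow_add_of_nonneg hgG hp0 hq0]
    have : p + q = 1 := by rw [hp, hq]; ring
    rw [this, Real.rpow_one]
  have h3 : ‖Complex.Gamma (x + y * Complex.I)‖ * c ≤ (1 + |y|) ^ q * (g * G) := by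
    calc ‖Complex.Gamma (x + y * Complex.I)‖ * c
        ≤ ‖Complex.Gamma (x + y * Complex.I)‖ * Real.Gamma x := by
          gcongr
          exact hmin hx
      _ ≤ _ := (h.trans h1).trans h2.le
  rw [← le_div_iff₀ hcpos] at h3
  refine h3.trans ?_
  rw [div_le_iff₀ hcpos]
  calc (1 + |y|) ^ q * (g * G)
      ≤ (1 + |y|) ^ q * ((3 * Real.exp (-(Real.pi / 2 * |y|))) * G) := by
        gcongr
        exact norm_Gamma_half_le y
    _ = _ := by field_simp

/-- Upper bound of Stirling type in the strip `-1/2 ≤ Re z ≤ 5/2`. -/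
theorem exists_norm_Gamma_le :
    ∃ C : ℝ, 0 < C ∧ ∀ z : ℂ, -1 / 2 ≤ z.re → z.re ≤ 5 / 2 → 1 ≤ z.im →
      ‖Complex.Gamma z‖ ≤ C * z.im ^ (z.re - 1 / 2) * Real.exp (-(Real.pi / 2 * z.im)) := by
  obtain ⟨C, hC, h⟩ := exists_norm_Gamma_le_of_mem_Icc
  have key : ∀ z : ℂ, 1 / 2 ≤ z.re → z.re ≤ 3 / 2 → 1 ≤ z.im →
      ‖Complex.Gamma z‖ ≤ 2 * C * z.im ^ (z.re - 1 / 2) * Real.exp (-(Real.pi / 2 * z.im)) := by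
    intro z h1 h2 h3
    have hb := h z.re ⟨h1, h2⟩ z.im
    rw [Complex.re_add_im, abs_of_pos (by linarith)] at hb
    refine hb.trans (mul_le_mul_of_nonneg_right ?_ (Real.exp_pos _).le)
    calc C * (1 + z.im) ^ (z.re - 1 / 2) ≤ C * (2 * z.im) ^ (z.re - 1 / 2) := by
          gcongr
          linarith
      _ = C * (2 ^ (z.re - 1 / 2) * z.im ^ (z.re - 1 / 2)) := by
          rw [Real.mul_rpow (by norm_num) (by linarith)]
      _ ≤ C * (2 ^ (1 : ℝ) * z.im ^ (z.re - 1 / 2)) := by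
          gcongr
          · norm_num
          · linarith
      _ = _ := by rw [Real.rpow_one]; ring
  -- One step of the recurrence to either side of the middle strip; on the right it costs `|z-1| ≤ 4
  -- Im z`, on the left it gains `|z| ≥ Im z`.
  refine ⟨8 * C, by positivity, fun z h1 h2 h3 => ?_⟩
  have hy : 0 < z.im := by linarith
  have hE := Real.exp_pos (-(Real.pi / 2 * z.im))
  rcases le_or_gt (1 / 2) z.re with h4 | h4
  · rcases le_or_gt z.re (3 / 2) with h5 | h5
    · refine (key z h4 h5 h3).trans ?_
      gcongr
      norm_num
    · have hb := key (z - 1) (by simp; linarith) (by simp; linarith) (by simpa using h3)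
      have hne : z - 1 ≠ 0 := fun h0 => by
        have := congrArg Complex.im h0
        simp at this
        linarith
      have hz := Complex.Gamma_add_one (z - 1) hne
      rw [sub_add_cancel] at hz
      simp only [Complex.sub_re, Complex.one_re, Complex.sub_im, Complex.one_im, sub_zero] at hb
      have hn : ‖z - 1‖ ≤ 4 * z.im := by
        refine (Complex.norm_le_abs_re_add_abs_im _).trans ?_
        simp only [Complex.sub_re, Complex.one_re, Complex.sub_im, Complex.one_im, sub_zero]
        rw [abs_of_pos (by linarith), abs_of_pos hy]
        linarith
      rw [hz, norm_mul]
      calc ‖z - 1‖ * ‖Complex.Gamma (z - 1)‖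
          ≤ (4 * z.im) * (2 * C * z.im ^ (z.re - 1 - 1 / 2)
            * Real.exp (-(Real.pi / 2 * z.im))) := by gcongr
        _ = 8 * C * (z.im ^ (z.re - 1 - 1 / 2) * z.im) * Real.exp (-(Real.pi / 2 * z.im)) := by
            ring
        _ = _ := by
            rw [← Real.rpow_add_one hy.ne']
            congr 3
            ring
  · have hb := key (z + 1) (by simp; linarith) (by simp; linarith) (by simpa using h3)
    have hne : z ≠ 0 := fun h0 => by
      rw [h0] at h3
      simp at h3
      linarith
    have hz := Complex.Gamma_add_one z hne
    simp only [Complex.add_re, Complex.one_re, Complex.add_im, Complex.one_im, add_zero] at hb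
    have hn : z.im ≤ ‖z‖ := (le_abs_self _).trans (Complex.abs_im_le_norm z)
    rw [hz, norm_mul] at hb
    have h6 : z.im * ‖Complex.Gamma z‖ ≤ 2 * C * z.im ^ (z.re + 1 - 1 / 2)
        * Real.exp (-(Real.pi / 2 * z.im)) := le_trans (by gcongr) hb
    have h7 : z.im ^ (z.re + 1 - 1 / 2) = z.im ^ (z.re - 1 / 2) * z.im := by
      rw [← Real.rpow_add_one hy.ne']
      congr 1
      ring
    rw [h7] at h6
    have h8 : ‖Complex.Gamma z‖ ≤ 2 * C * z.im ^ (z.re - 1 / 2)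
        * Real.exp (-(Real.pi / 2 * z.im)) := by
      refine le_of_mul_le_mul_left ?_ hy
      linarith
    refine h8.trans ?_
    gcongr
    norm_num

theorem contDiff_norm_Gamma {x : ℝ} (hx : 0 < x) :
    ContDiff ℝ 1 fun y : ℝ => ‖Complex.Gamma (x + y * Complex.I)‖ := by
  have hre : ∀ y : ℝ, 0 < ((x : ℂ) + y * Complex.I).re := fun y => by simpa using hx
  have hopen : IsOpen {z : ℂ | 0 < z.re} := isOpen_lt continuous_const Complex.continuous_re
  have hd : DifferentiableOn ℂ Complex.Gamma {z : ℂ | 0 < z.re} := fun z hz =>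
    (Complex.differentiableAt_Gamma z fun m h => by
      rw [Set.mem_ofPred_eq, h, Complex.neg_re, Complex.natCast_re] at hz
      linarith [m.cast_nonneg (α := ℝ)]).differentiableWithinAt
  refine contDiff_iff_contDiffAt.mpr fun y => ?_
  have h1 : ContDiffAt ℝ 1 Complex.Gamma (x + y * Complex.I) :=
    ((hd.contDiffOn hopen).contDiffAt (hopen.mem_nhds (hre y))).restrict_scalars ℝ
  have h2 : ContDiffAt ℝ 1 (fun y : ℝ => (x : ℂ) + y * Complex.I) y :=
    (contDiff_const.add (Complex.ofRealCLM.contDiff.mul contDiff_const)).contDiffAt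
  exact (h1.comp y h2).norm ℝ (Complex.Gamma_ne_zero_of_re_pos (hre y))

/-- In Euler's product for the quotient every factor `|a+j+iy| / |b+j+iy|` increases with `y ≥ 0`,
because `a ≤ b`. -/
theorem monotoneOn_norm_Gamma_div_norm_Gamma {a b : ℝ} (ha : 0 < a) (hab : a ≤ b) :
    MonotoneOn (fun y : ℝ => ‖Complex.Gamma (b + y * Complex.I)‖
      / ‖Complex.Gamma (a + y * Complex.I)‖) (Set.Ici 0) := by
  intro u hu v hv huv
  have hb : 0 < b := ha.trans_le hab
  have hlim : ∀ y : ℝ, Filter.Tendsto (fun n => ‖Complex.GammaSeq (b + y * Complex.I) n‖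
      / ‖Complex.GammaSeq (a + y * Complex.I) n‖) Filter.atTop
      (nhds (‖Complex.Gamma (b + y * Complex.I)‖ / ‖Complex.Gamma (a + y * Complex.I)‖)) :=
    fun y => (Complex.GammaSeq_tendsto_Gamma _).norm.div (Complex.GammaSeq_tendsto_Gamma _).norm
      (norm_ne_zero_iff.mpr (Complex.Gamma_ne_zero_of_re_pos (by simpa using ha)))
  refine le_of_tendsto_of_tendsto (hlim u) (hlim v) ?_
  filter_upwards [Filter.eventually_gt_atTop 0] with n hn
  have hn' : (0 : ℝ) < n := by exact_mod_cast hn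
  have hform : ∀ y : ℝ, ‖Complex.GammaSeq (b + y * Complex.I) n‖
      / ‖Complex.GammaSeq (a + y * Complex.I) n‖ = (n : ℝ) ^ b / (n : ℝ) ^ a
        * ∏ j ∈ Finset.range (n + 1), (‖((a + j : ℝ) : ℂ) + y * Complex.I‖
          / ‖((b + j : ℝ) : ℂ) + y * Complex.I‖) := by
    intro y
    have h1 : ∏ j ∈ Finset.range (n + 1), ‖((a + j : ℝ) : ℂ) + y * Complex.I‖ ≠ 0 :=
      Finset.prod_ne_zero_iff.mpr fun j _ => (norm_ofReal_add_mul_I_pos (by positivity) y).ne'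
    have h2 : ∏ j ∈ Finset.range (n + 1), ‖((b + j : ℝ) : ℂ) + y * Complex.I‖ ≠ 0 :=
      Finset.prod_ne_zero_iff.mpr fun j _ => (norm_ofReal_add_mul_I_pos (by positivity) y).ne'
    have h3 : (n : ℝ) ^ a ≠ 0 := (Real.rpow_pos_of_pos hn' a).ne'
    rw [norm_Complex_GammaSeq y hn, norm_Complex_GammaSeq y hn, Finset.prod_div_distrib]
    field_simp
  rw [hform, hform]
  refine mul_le_mul_of_nonneg_left (Finset.prod_le_prod (fun j _ => by positivity) fun j _ => ?_)
    (by positivity)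
  rw [div_le_div_iff₀ (norm_ofReal_add_mul_I_pos (by positivity) u)
    (norm_ofReal_add_mul_I_pos (by positivity) v)]
  simp only [Complex.norm_add_mul_I]
  rw [← Real.sqrt_mul (by positivity), ← Real.sqrt_mul (by positivity)]
  refine Real.sqrt_le_sqrt ?_
  have h1 : u ^ 2 ≤ v ^ 2 := pow_le_pow_left₀ hu huv 2
  have h2 : (a + j) ^ 2 ≤ (b + j) ^ 2 := pow_le_pow_left₀ (by positivity) (by linarith) 2
  nlinarith [mul_nonneg (sub_nonneg.mpr h1) (sub_nonneg.mpr h2)]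

/-- A lower bound for `|Γ(1/4+iy)|` is required. Log-convexity at `1/2`, the midpoint of `1/4` and
`3/4`, bounds the quotient by a constant times `|Γ(3/4+iy)| / |Γ(1/2+iy)|`, where only an upper
bound above and the exact modulus below enter. -/
theorem exists_norm_Gamma_half_div_le :
    ∃ C : ℝ, 0 < C ∧ ∀ y : ℝ, 1 ≤ y → ‖Complex.Gamma ((1 / 2 : ℝ) + y * Complex.I)‖
      / ‖Complex.Gamma ((1 / 4 : ℝ) + y * Complex.I)‖ ≤ C * y ^ (1 / 4 : ℝ) := by
  obtain ⟨C, hC, hb⟩ := exists_norm_Gamma_le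
  refine ⟨Real.Gamma (1 / 4) * Real.Gamma (3 / 4) * C, ?_, fun y hy => ?_⟩
  · have := Real.Gamma_pos_of_pos (show (0 : ℝ) < 1 / 4 by norm_num)
    have := Real.Gamma_pos_of_pos (show (0 : ℝ) < 3 / 4 by norm_num)
    positivity
  have hG1 := Real.Gamma_pos_of_pos (show (0 : ℝ) < 1 / 4 by norm_num)
  have hG3 := Real.Gamma_pos_of_pos (show (0 : ℝ) < 3 / 4 by norm_num)
  have h := norm_Gamma_mul_Gamma_le (a := 1 / 4) (b := 3 / 4) (p := 1 / 2) (q := 1 / 2) y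
    (by norm_num) (by norm_num) (by norm_num) (by norm_num) (by norm_num)
  have he : (1 / 2 : ℝ) * (1 / 4) + 1 / 2 * (3 / 4) = 1 / 2 := by norm_num
  rw [he, ← Real.mul_rpow (by positivity) (by positivity), ← Real.sqrt_eq_rpow] at h
  have h1 := hb ((3 / 4 : ℝ) + y * Complex.I) (by simp; norm_num) (by simp; norm_num) (by simpa)
  have hre : (((3 / 4 : ℝ) : ℂ) + y * Complex.I).re = 3 / 4 := by simp
  have him : (((3 / 4 : ℝ) : ℂ) + y * Complex.I).im = y := by simp
  rw [hre, him] at h1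
  set g := ‖Complex.Gamma ((1 / 2 : ℝ) + y * Complex.I)‖ with hg
  set g1 := ‖Complex.Gamma ((1 / 4 : ℝ) + y * Complex.I)‖ with hg1
  set g3 := ‖Complex.Gamma ((3 / 4 : ℝ) + y * Complex.I)‖ with hg3
  have hg1pos : 0 < g1 := norm_pos_iff.mpr (Complex.Gamma_ne_zero_of_re_pos (by simp))
  have hgpos : 0 < g := norm_pos_iff.mpr (Complex.Gamma_ne_zero_of_re_pos (by simp))
  have hsq : (g * Real.Gamma (1 / 2)) ^ 2
      ≤ g1 * Real.Gamma (1 / 4) * (g3 * Real.Gamma (3 / 4)) := by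
    calc (g * Real.Gamma (1 / 2)) ^ 2
        ≤ (√(g1 * Real.Gamma (1 / 4) * (g3 * Real.Gamma (3 / 4)))) ^ 2 := by
          gcongr
      _ = _ := Real.sq_sqrt (by positivity)
  rw [mul_pow, Real.Gamma_one_half_eq, Real.sq_sqrt Real.pi_pos.le] at hsq
  have hlow : Real.exp (-(Real.pi / 2 * y)) ≤ g := by
    refine le_of_sq_le_sq ?_ hgpos.le
    rw [hg, norm_Gamma_half_sq, ← Real.exp_nat_mul, le_div_iff₀ (Real.cosh_pos _), Real.cosh_eq]
    have h2 : (((2 : ℕ) : ℝ) * -(Real.pi / 2 * y)) = -(Real.pi * y) := by push_cast; ring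
    rw [h2]
    have h3 : Real.exp (-(Real.pi * y)) * Real.exp (Real.pi * y) = 1 := by
      rw [← Real.exp_add]; simp
    have h4 : Real.exp (-(Real.pi * y)) ≤ 1 := by
      rw [Real.exp_le_one_iff]
      have := Real.pi_pos
      nlinarith
    have h5 := Real.exp_pos (-(Real.pi * y))
    nlinarith [Real.pi_gt_three]
  rw [div_le_iff₀ hg1pos]
  have hy4 : (3 / 4 : ℝ) - 1 / 2 = 1 / 4 := by norm_num
  rw [hy4] at h1
  have hyp : 0 < y ^ (1 / 4 : ℝ) := Real.rpow_pos_of_pos (by linarith) _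
  have h6 : g3 ≤ C * y ^ (1 / 4 : ℝ) * g := h1.trans (by gcongr)
  have h7 : g ^ 2 * 1 ≤ g ^ 2 * Real.pi := by
    gcongr
    linarith [Real.pi_gt_three]
  have h8 : g1 * Real.Gamma (1 / 4) * (g3 * Real.Gamma (3 / 4))
      ≤ g1 * Real.Gamma (1 / 4) * ((C * y ^ (1 / 4 : ℝ) * g) * Real.Gamma (3 / 4)) := by
    gcongr
  have h9 : g * g ≤ g * (Real.Gamma (1 / 4) * Real.Gamma (3 / 4) * C * y ^ (1 / 4 : ℝ) * g1) := by
    nlinarith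
  exact le_of_mul_le_mul_left h9 hgpos

/-! ### Mellin transforms: Euler's integral and boundedness on strips. -/

/-- The Gamma integral with a complex rate. -/
theorem integral_cpow_mul_exp_neg_cmul_Ioi {z : ℂ} (hz : 0 < z.re) {r : ℂ} (hr : 0 < r.re) :
    ∫ u in Set.Ioi (0 : ℝ), (u : ℂ) ^ (z - 1) * Complex.exp (-(r * u))
      = (1 / r) ^ z * Complex.Gamma z := by
  set U : Set ℂ := {r : ℂ | 0 < r.re} with hU
  have hopen : IsOpen U := isOpen_lt continuous_const Complex.continuous_re
  have hmeas : ∀ r : ℂ, ∀ z : ℂ, MeasureTheory.AEStronglyMeasurable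
      (fun u : ℝ => (u : ℂ) ^ z * Complex.exp (-(r * u)))
      (MeasureTheory.volume.restrict (Set.Ioi 0)) := by
    intro r z
    refine ContinuousOn.aestronglyMeasurable (fun u hu => ?_) measurableSet_Ioi
    refine ContinuousAt.continuousWithinAt (ContinuousAt.mul ?_ (by fun_prop))
    exact Complex.continuousAt_ofReal_cpow_const _ _ (Or.inr (ne_of_gt hu))
  have hnorm : ∀ r z : ℂ, ∀ u ∈ Set.Ioi (0 : ℝ),
      ‖(u : ℂ) ^ z * Complex.exp (-(r * u))‖ = u ^ z.re * Real.exp (-(r.re * u)) := by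
    intro r z u hu
    rw [norm_mul, Complex.norm_cpow_eq_rpow_re_of_pos hu, Complex.norm_exp]
    simp
  have hint : ∀ x : ℝ, -1 < x → ∀ b : ℝ, 0 < b → MeasureTheory.IntegrableOn
      (fun u : ℝ => u ^ x * Real.exp (-(b * u))) (Set.Ioi 0) := by
    intro x hx b hb
    simpa only [neg_mul] using integrableOn_rpow_mul_exp_neg_mul_rpow (s := x) (p := 1) hx
      one_pos hb |>.congr_fun (fun u _ => by simp) measurableSet_Ioi
  have hderiv : ∀ r ∈ U, DifferentiableAt ℂ (fun r : ℂ => ∫ u in Set.Ioi (0 : ℝ),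
      (u : ℂ) ^ (z - 1) * Complex.exp (-(r * u))) r := by
    intro r hr
    have hr0 : 0 < r.re := hr
    refine (hasDerivAt_integral_of_dominated_loc_of_deriv_le
      (F := fun (r : ℂ) (u : ℝ) => (u : ℂ) ^ (z - 1) * Complex.exp (-(r * u)))
      (F' := fun (r : ℂ) (u : ℝ) => (u : ℂ) ^ (z - 1) * (Complex.exp (-(r * u)) * (-u)))
      (bound := fun u : ℝ => u ^ z.re * Real.exp (-(r.re / 2 * u)))
      (Metric.ball_mem_nhds r (half_pos hr0)) (Filter.Eventually.of_forall fun r => hmeas r _)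
      ?_ ?_ ?_ (hint _ (by linarith) _ (half_pos hr0)) ?_).2.differentiableAt
    · refine (hint (z.re - 1) (by linarith) r.re hr0).mono' (hmeas r _) ?_
      filter_upwards [MeasureTheory.ae_restrict_mem measurableSet_Ioi] with u hu
      rw [hnorm r _ u hu]
      simp
    · simp only [← mul_assoc]
      exact (hmeas r (z - 1)).mul (by fun_prop)
    · filter_upwards [MeasureTheory.ae_restrict_mem measurableSet_Ioi] with u hu w hw
      have hu0 : (0 : ℝ) < u := hu
      rw [← mul_assoc, norm_mul, hnorm w _ u hu, norm_neg, Complex.norm_real, Real.norm_eq_abs,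
        abs_of_pos hu0, mul_right_comm]
      have h1 : u ^ (z - 1).re * u = u ^ z.re := by
        rw [← Real.rpow_add_one hu0.ne']
        simp
      have h2 : r.re / 2 ≤ w.re := by
        have h3 := (Complex.abs_re_le_norm (w - r)).trans (mem_ball_iff_norm.mp hw).le
        rw [Complex.sub_re] at h3
        linarith [(abs_le.mp h3).1]
      rw [h1]
      gcongr
    · filter_upwards with u w _
      refine HasDerivAt.const_mul _ ?_
      have := ((hasDerivAt_id w).mul_const (u : ℂ)).neg.cexp
      simpa using this
  have hslit : ∀ r ∈ U, r ∈ Complex.slitPlane := fun r hr => Or.inl hr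
  have hf : AnalyticOnNhd ℂ (fun r : ℂ => ∫ u in Set.Ioi (0 : ℝ),
      (u : ℂ) ^ (z - 1) * Complex.exp (-(r * u))) U :=
    (DifferentiableOn.analyticOnNhd (fun r hr => (hderiv r hr).differentiableWithinAt) hopen)
  have hg : AnalyticOnNhd ℂ (fun r : ℂ => r ^ (-z) * Complex.Gamma z) U := by
    refine DifferentiableOn.analyticOnNhd (fun r hr => ?_) hopen
    exact ((differentiableAt_id.cpow_const (hslit r hr)).mul_const _).differentiableWithinAt
  have heq : Set.EqOn (fun r : ℂ => ∫ u in Set.Ioi (0 : ℝ),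
      (u : ℂ) ^ (z - 1) * Complex.exp (-(r * u))) (fun r : ℂ => r ^ (-z) * Complex.Gamma z) U := by
    -- Both sides are holomorphic in the rate on the right half plane and agree at the real points
    -- `1 + 1/(n+1)`, which accumulate at `1`.
    refine hf.eqOn_of_preconnected_of_frequently_eq hg
      (convex_halfSpace_re_gt 0).isPreconnected (z₀ := 1) (by simp [hU]) ?_
    have ht : Filter.Tendsto (fun n : ℕ => ((1 + 1 / ((n : ℝ) + 1) : ℝ) : ℂ)) Filter.atTop
        (nhdsWithin 1 {1}ᶜ) := by
      refine tendsto_nhdsWithin_iff.mpr ⟨?_, Filter.Eventually.of_forall fun n => ?_⟩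
      · have := (tendsto_one_div_add_atTop_nhds_zero_nat (𝕜 := ℝ)).const_add 1
        rw [add_zero] at this
        exact_mod_cast (Complex.continuous_ofReal.tendsto 1).comp this
      · have : (0 : ℝ) < 1 / ((n : ℝ) + 1) := by positivity
        rw [Set.mem_compl_iff, Set.mem_singleton_iff, Complex.ofReal_eq_one]
        linarith
    refine ht.frequently (Filter.Frequently.of_forall fun n => ?_)
    have hpos : (0 : ℝ) < 1 + 1 / ((n : ℝ) + 1) := by positivity
    rw [Complex.integral_cpow_mul_exp_neg_mul_Ioi hz hpos, one_div, Complex.inv_cpow,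
      Complex.cpow_neg]
    rw [Complex.arg_ofReal_of_nonneg hpos.le]
    exact Real.pi_pos.ne
  have := heq (show r ∈ U from hr)
  simp only at this
  rw [this, one_div, Complex.inv_cpow, Complex.cpow_neg]
  intro h
  exact (Complex.mem_slitPlane_iff_arg.mp (hslit r hr)).1 h

/-- A Mellin transform is bounded on vertical strips inside its strip of convergence. -/
theorem norm_mellin_le_of_mem_strip {f : ℝ → ℂ} {a b : ℝ} (ha : MellinConvergent f a)
    (hb : MellinConvergent f b) {s : ℂ} (h1 : a ≤ s.re) (h2 : s.re ≤ b) :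
    ‖mellin f s‖ ≤ (∫ u in Set.Ioi (0 : ℝ), ‖(u : ℂ) ^ ((a : ℂ) - 1) • f u‖)
      + ∫ u in Set.Ioi (0 : ℝ), ‖(u : ℂ) ^ ((b : ℂ) - 1) • f u‖ := by
  rw [← MeasureTheory.integral_add ha.norm hb.norm, mellin]
  refine MeasureTheory.norm_integral_le_of_norm_le (ha.norm.add hb.norm) ?_
  filter_upwards [MeasureTheory.ae_restrict_mem measurableSet_Ioi] with u hu
  have hu0 : (0 : ℝ) < u := hu
  rw [norm_smul, norm_smul, norm_smul, Complex.norm_cpow_eq_rpow_re_of_pos hu0,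
    Complex.norm_cpow_eq_rpow_re_of_pos hu0, Complex.norm_cpow_eq_rpow_re_of_pos hu0, ← add_mul]
  refine mul_le_mul_of_nonneg_right ?_ (norm_nonneg _)
  simp only [Complex.sub_re, Complex.ofReal_re, Complex.one_re]
  rcases le_total u 1 with h | h
  · exact (Real.rpow_le_rpow_of_exponent_ge hu0 h (by linarith)).trans
      (le_add_of_nonneg_right (by positivity))
  · exact (Real.rpow_le_rpow_of_exponent_le h (by linarith)).trans
      (le_add_of_nonneg_left (by positivity))

/-- The entire part of the completed zeta function is a Mellin transform convergent for every `s`.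
This crude bound supplies the growth condition for the Phragmén–Lindelöf principle. -/
theorem exists_norm_completedRiemannZeta₀_le (a b : ℝ) :
    ∃ M : ℝ, 0 ≤ M ∧ ∀ s : ℂ, a ≤ s.re → s.re ≤ b → ‖completedRiemannZeta₀ s‖ ≤ M := by
  set P := HurwitzZeta.hurwitzEvenFEPair 0 with hP
  have hconv : ∀ s : ℂ, MellinConvergent P.f_modif s := fun s =>
    (P.isStrongFEPair_toStrongFEPair.hasMellin s).1
  refine ⟨((∫ u in Set.Ioi (0 : ℝ), ‖(u : ℂ) ^ (((a / 2 : ℝ) : ℂ) - 1) • P.f_modif u‖)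
      + ∫ u in Set.Ioi (0 : ℝ), ‖(u : ℂ) ^ (((b / 2 : ℝ) : ℂ) - 1) • P.f_modif u‖) / 2, ?_, ?_⟩
  · positivity
  · intro s h1 h2
    have h : completedRiemannZeta₀ s = mellin P.f_modif (s / 2) / 2 := rfl
    have hre : (s / 2).re = s.re / 2 := by simp
    rw [h, norm_div, Complex.norm_ofNat]
    gcongr
    exact norm_mellin_le_of_mem_strip (hconv _) (hconv _) (by linarith) (by linarith)

/-! ### The rotated zeta function and its convexity bound. -/

/-- The completed zeta function at `2z`, rotated so that it has moderate size in the upper half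
plane. -/
noncomputable def rotatedZeta (z : ℂ) : ℂ :=
  completedRiemannZeta (2 * z) * Complex.exp (-(Real.pi / 2 * z * Complex.I))

theorem norm_rotation (α : ℝ) (z : ℂ) :
    ‖Complex.exp (-(α * z * Complex.I))‖ = Real.exp (α * z.im) := by
  rw [Complex.norm_exp]
  simp

/-- The Dirichlet series is bounded by its value at `1 + 2η`, so the size is that of the Gamma
factor. -/
theorem exists_norm_completedRiemannZeta_le {η : ℝ} (hη : 0 < η) (hη' : η ≤ 1 / 2) :
    ∃ C : ℝ, 0 < C ∧ ∀ z : ℂ, z.re = 1 / 2 + η → ‖completedRiemannZeta (2 * z)‖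
      ≤ C * (1 + |z.im|) ^ η * Real.exp (-(Real.pi / 2 * |z.im|)) := by
  obtain ⟨C, hC, h⟩ := exists_norm_Gamma_le_of_mem_Icc
  set S := ∑' n : ℕ, 1 / (n : ℝ) ^ (1 + 2 * η) with hS
  have hsum : Summable fun n : ℕ => 1 / (n : ℝ) ^ (1 + 2 * η) :=
    Real.summable_one_div_nat_rpow.mpr (by linarith)
  have hS0 : 0 ≤ S := tsum_nonneg fun n => by positivity
  refine ⟨C * (S + 1), by positivity, fun z hz => ?_⟩
  have hre : (2 * z).re = 1 + 2 * η := by simp [hz]; ring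
  have hdir : ‖∑' n : ℕ, 1 / (n : ℂ) ^ (2 * z)‖ ≤ S := by
    refine tsum_of_norm_bounded hsum.hasSum fun n => ?_
    rcases Nat.eq_zero_or_pos n with rfl | hn
    · have : (2 * z) ≠ 0 := fun h0 => by rw [h0] at hre; simp at hre; linarith
      simp [Complex.zero_cpow this]
      positivity
    · rw [norm_div, norm_one, Complex.norm_natCast_cpow_of_pos hn, hre]
  have hg := h z.re ⟨by linarith, by linarith⟩ z.im
  rw [Complex.re_add_im] at hg
  rw [completedZeta_eq_tsum_of_one_lt_re (by linarith), norm_mul, norm_mul,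
    Complex.norm_cpow_eq_rpow_re_of_pos Real.pi_pos, mul_div_cancel_left₀ z two_ne_zero]
  have hexp : z.re - 1 / 2 = η := by linarith
  rw [hexp] at hg
  have hpi : Real.pi ^ (-(2 * z) / 2).re ≤ 1 := by
    refine Real.rpow_le_one_of_one_le_of_nonpos (by linarith [Real.pi_gt_three]) ?_
    have : (-(2 * z) / 2).re = -z.re := by
      rw [show -(2 * z) / 2 = -z by ring]; simp
    rw [this]
    linarith
  calc Real.pi ^ (-(2 * z) / 2).re * ‖Complex.Gamma z‖ * ‖∑' n : ℕ, 1 / (n : ℂ) ^ (2 * z)‖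
      ≤ 1 * (C * (1 + |z.im|) ^ η * Real.exp (-(Real.pi / 2 * |z.im|))) * (S + 1) := by
        gcongr
        linarith
    _ = _ := by ring

/-- The polynomial factor cancels both poles, so the right side is entire and Phragmén–Lindelöf can
be applied to it. -/
theorem mul_completedRiemannZeta {z : ℂ} (h0 : z ≠ 0) (h1 : z ≠ 1 / 2) :
    z * (z - 1 / 2) * completedRiemannZeta (2 * z)
      = z * (z - 1 / 2) * completedRiemannZeta₀ (2 * z) + 1 / 4 := by
  have h2 : 1 - 2 * z ≠ 0 := fun h => h1 (by linear_combination (-1 / 2 : ℂ) * h)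
  have h3 : z * (z - 1 / 2) * (1 / (1 - 2 * z)) = -z / 2 := by
    rw [mul_one_div, div_eq_iff h2]
    ring
  have h4 : z * (z - 1 / 2) * (1 / (2 * z)) = (z - 1 / 2) / 2 := by
    field_simp
  rw [completedRiemannZeta_eq]
  linear_combination -h3 - h4

/-- The convexity bound for the zeta function, in the rotated normalisation. -/
theorem exists_norm_rotatedZeta_le {η : ℝ} (hη : 0 < η) (hη' : η ≤ 1 / 2) :
    ∃ C : ℝ, 0 < C ∧ ∀ z : ℂ, -η ≤ z.re → z.re ≤ 1 / 2 + η → 1 ≤ z.im →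
      ‖rotatedZeta z‖ ≤ C * z.im ^ η := by
  obtain ⟨C, hC, hedge⟩ := exists_norm_completedRiemannZeta_le hη hη'
  obtain ⟨M, hM, hM'⟩ := exists_norm_completedRiemannZeta₀_le (-(2 * η)) (1 + 2 * η)
  -- The poles are removed by `z(z-1/2)`; dividing by `(z+1)^{2+η}` compensates for this factor and
  -- for the growth `y^η`, so that `F` is bounded on both edges of the strip.
  set F : ℂ → ℂ := fun z => (z * (z - 1 / 2) * completedRiemannZeta₀ (2 * z) + 1 / 4)
    * Complex.exp (-((Real.pi / 2 : ℝ) * z * Complex.I)) / (z + 1) ^ ((2 + η : ℝ) : ℂ) with hF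
  have hgeom : ∀ z : ℂ, -η ≤ z.re → 1 / 2 ≤ ‖z + 1‖ ∧ ‖z‖ ≤ 3 * ‖z + 1‖ ∧
      ‖z - 1 / 2‖ ≤ 4 * ‖z + 1‖ ∧ 1 + |z.im| ≤ 3 * ‖z + 1‖ := by
    intro z hz
    have h1 : 1 / 2 ≤ ‖z + 1‖ := by
      refine le_trans ?_ ((le_abs_self _).trans (Complex.abs_re_le_norm _))
      simp
      linarith
    have h2 : |z.im| ≤ ‖z + 1‖ := by
      simpa using Complex.abs_im_le_norm (z + 1)
    have h3 : ‖z‖ ≤ ‖z + 1‖ + 1 := by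
      have := norm_sub_le (z + 1) 1
      simpa using this
    have h4 : ‖z - 1 / 2‖ ≤ ‖z + 1‖ + 3 / 2 := by
      have := norm_sub_le (z + 1) (3 / 2)
      rw [show z + 1 - 3 / 2 = z - 1 / 2 by ring] at this
      norm_num at this
      exact this
    exact ⟨h1, by linarith, by linarith, by linarith⟩
  have hcp : ∀ z : ℂ, ‖(z + 1) ^ ((2 + η : ℝ) : ℂ)‖ = ‖z + 1‖ ^ (2 + η) := fun z =>
    Complex.norm_cpow_real _ _
  have hdiff : ∀ z : ℂ, -1 < z.re → DifferentiableAt ℂ F z := by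
    intro z hz
    have hs : z + 1 ∈ Complex.slitPlane := Or.inl (by simp; linarith)
    have hc : DifferentiableAt ℂ (fun z : ℂ => (z + 1) ^ ((2 + η : ℝ) : ℂ)) z :=
      (differentiableAt_id.add_const 1).cpow_const hs
    have hz0 : DifferentiableAt ℂ (fun z : ℂ => completedRiemannZeta₀ (2 * z)) z :=
      (differentiable_completedZeta₀.comp (differentiable_id.const_mul 2)).differentiableAt
    refine DifferentiableAt.div ?_ hc ?_
    · fun_prop
    · rw [Complex.cpow_ne_zero_iff]
      exact Or.inl (Complex.slitPlane_ne_zero hs)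
  have hnorm : ∀ z : ℂ, z ≠ 0 → z ≠ 1 / 2 → ‖F z‖ = ‖z‖ * ‖z - 1 / 2‖ *
      ‖completedRiemannZeta (2 * z)‖ * Real.exp (Real.pi / 2 * z.im) / ‖z + 1‖ ^ (2 + η) := by
    intro z h0 h1
    rw [hF]
    simp only
    rw [← mul_completedRiemannZeta h0 h1, norm_div, norm_mul, norm_mul, norm_mul, norm_rotation,
      hcp]
  have hline : ∀ z : ℂ, z ≠ 0 → z ≠ 1 / 2 → -η ≤ z.re →
      ‖completedRiemannZeta (2 * z)‖
        ≤ C * (1 + |z.im|) ^ η * Real.exp (-(Real.pi / 2 * |z.im|)) →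
      ‖F z‖ ≤ 36 * C := by
    intro z h0 h1 hz hb
    obtain ⟨g1, g2, g3, g4⟩ := hgeom z hz
    have hpos : 0 < ‖z + 1‖ := by linarith
    rw [hnorm z h0 h1, div_le_iff₀ (Real.rpow_pos_of_pos hpos _)]
    have hee : Real.exp (-(Real.pi / 2 * |z.im|)) * Real.exp (Real.pi / 2 * z.im) ≤ 1 := by
      rw [← Real.exp_add, Real.exp_le_one_iff]
      have := le_abs_self z.im
      nlinarith [Real.pi_pos]
    have h3 : (3 : ℝ) ^ η ≤ 3 := by
      calc (3 : ℝ) ^ η ≤ 3 ^ (1 : ℝ) := Real.rpow_le_rpow_of_exponent_le (by norm_num) (by linarith)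
        _ = 3 := Real.rpow_one _
    calc ‖z‖ * ‖z - 1 / 2‖ * ‖completedRiemannZeta (2 * z)‖ * Real.exp (Real.pi / 2 * z.im)
        ≤ (3 * ‖z + 1‖) * (4 * ‖z + 1‖) * (C * (3 * ‖z + 1‖) ^ η
            * Real.exp (-(Real.pi / 2 * |z.im|))) * Real.exp (Real.pi / 2 * z.im) := by
          have : ‖completedRiemannZeta (2 * z)‖ ≤ C * (3 * ‖z + 1‖) ^ η
              * Real.exp (-(Real.pi / 2 * |z.im|)) := hb.trans (by gcongr)
          gcongr
      _ = 12 * C * (3 ^ η) * (‖z + 1‖ ^ 2 * ‖z + 1‖ ^ η)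
            * (Real.exp (-(Real.pi / 2 * |z.im|)) * Real.exp (Real.pi / 2 * z.im)) := by
          rw [Real.mul_rpow (by norm_num) hpos.le]
          ring
      _ ≤ 12 * C * 3 * (‖z + 1‖ ^ 2 * ‖z + 1‖ ^ η) * 1 := by gcongr
      _ = 36 * C * ‖z + 1‖ ^ (2 + η) := by
          rw [Real.rpow_add hpos, Real.rpow_two]
          ring
  have hbound : ∀ z : ℂ, -η ≤ z.re → z.re ≤ 1 / 2 + η → ‖F z‖ ≤ 36 * C := by
    intro z hz1 hz2
    refine PhragmenLindelof.vertical_strip (a := -η) (b := 1 / 2 + η) ?_ ?_ ?_ ?_ hz1 hz2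
    · refine ⟨fun w hw => (hdiff w ?_).differentiableWithinAt, fun w hw => ?_⟩
      · have := hw.1
        linarith
      · refine (hdiff w ?_).continuousAt.continuousWithinAt
        have h1 : closure (Complex.re ⁻¹' Set.Ioo (-η) (1 / 2 + η))
            ⊆ Complex.re ⁻¹' Set.Icc (-η) (1 / 2 + η) :=
          closure_minimal (Set.preimage_mono Set.Ioo_subset_Icc_self)
            (isClosed_Icc.preimage Complex.continuous_re)
        have := (h1 hw).1
        linarith
    -- The strip has width at most `3/2`, so the rate `1` is below `π / width`; the rotation
    -- `e^{πy/2}` is the only exponential growth.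
    · refine ⟨1, ?_, Real.pi / 2, ?_⟩
      · rw [lt_div_iff₀ (by linarith)]
        linarith [Real.pi_gt_three]
      · refine Asymptotics.IsBigO.of_bound (2 ^ 3 * (3 * 4 * M) + 2 ^ 3) ?_
        refine Filter.eventually_inf_principal.mpr (Filter.Eventually.of_forall fun w hw => ?_)
        obtain ⟨g1, g2, g3, -⟩ := hgeom w hw.1.le
        have hpos : 0 < ‖w + 1‖ := by linarith
        have hη1 : (1 / 2 : ℝ) ^ (1 : ℝ) ≤ ‖w + 1‖ ^ η := by
          calc (1 / 2 : ℝ) ^ (1 : ℝ) ≤ (1 / 2) ^ η :=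
                Real.rpow_le_rpow_of_exponent_ge (by norm_num) (by norm_num) (by linarith)
            _ ≤ _ := by gcongr
        rw [Real.rpow_one] at hη1
        have hMw : ‖completedRiemannZeta₀ (2 * w)‖ ≤ M := by
          refine hM' _ ?_ ?_
          · have := hw.1
            simp
            linarith
          · have := hw.2
            simp
            linarith
        have hq : ‖w * (w - 1 / 2) * completedRiemannZeta₀ (2 * w) + 1 / 4‖
            ≤ 3 * 4 * M * ‖w + 1‖ ^ 2 + 1 / 4 := by
          refine (norm_add_le _ _).trans ?_
          rw [norm_mul, norm_mul]
          norm_num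
          calc ‖w‖ * ‖w - 1 / 2‖ * ‖completedRiemannZeta₀ (2 * w)‖
              ≤ (3 * ‖w + 1‖) * (4 * ‖w + 1‖) * M := by gcongr
            _ = _ := by ring
        have hq2 : 3 * 4 * M * ‖w + 1‖ ^ 2 + 1 / 4
            ≤ (2 ^ 3 * (3 * 4 * M) + 2 ^ 3) * ‖w + 1‖ ^ (2 + η) := by
          rw [Real.rpow_add hpos, Real.rpow_two]
          have h5 : (1 / 2) ^ 2 ≤ ‖w + 1‖ ^ 2 := by gcongr
          have h6 : ‖w + 1‖ ^ 2 * (1 / 2) ≤ ‖w + 1‖ ^ 2 * ‖w + 1‖ ^ η := by gcongr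
          have h7 : 0 ≤ M * ‖w + 1‖ ^ 2 := by positivity
          have h8 : M * (‖w + 1‖ ^ 2 * (1 / 2)) ≤ M * (‖w + 1‖ ^ 2 * ‖w + 1‖ ^ η) := by gcongr
          nlinarith
        rw [hF]
        simp only
        rw [norm_div, norm_mul, norm_rotation, hcp, Real.norm_eq_abs, Real.abs_exp, one_mul,
          div_le_iff₀ (Real.rpow_pos_of_pos hpos _)]
        calc ‖w * (w - 1 / 2) * completedRiemannZeta₀ (2 * w) + 1 / 4‖
              * Real.exp (Real.pi / 2 * w.im)
            ≤ ((2 ^ 3 * (3 * 4 * M) + 2 ^ 3) * ‖w + 1‖ ^ (2 + η))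
              * Real.exp (Real.pi / 2 * Real.exp |w.im|) := by
              refine mul_le_mul (hq.trans hq2) ?_ (Real.exp_pos _).le (by positivity)
              have h9 := le_abs_self w.im
              have h10 := Real.add_one_le_exp |w.im|
              have := Real.pi_pos
              gcongr
              linarith
          _ = _ := by ring
    · intro w hw
      refine hline w ?_ ?_ hw.ge ?_
      · intro h; rw [h] at hw; simp at hw; linarith
      · intro h; rw [h] at hw; norm_num at hw; linarith
      -- The functional equation carries the left edge to the right one.
      · have h1 := hedge (1 / 2 - w) (by simp [hw])
        rw [show 2 * (1 / 2 - w) = 1 - 2 * w by ring, completedRiemannZeta_one_sub] at h1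
        have h2 : (1 / 2 - w).im = -w.im := by simp
        rwa [h2, abs_neg] at h1
    · intro w hw
      refine hline w ?_ ?_ (by linarith) (hedge w hw)
      · intro h; rw [h] at hw; simp at hw; linarith
      · intro h; rw [h] at hw; norm_num at hw; linarith
  refine ⟨36 * C * 4 ^ (2 + η), by positivity, fun z hz1 hz2 hz3 => ?_⟩
  have hy : 0 < z.im := by linarith
  have h0 : z ≠ 0 := by rintro rfl; simp at hy
  have h1 : z ≠ 1 / 2 := by rintro rfl; norm_num at hy
  have hb := hbound z hz1 hz2
  obtain ⟨g1, -, -, -⟩ := hgeom z hz1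
  have hpos : 0 < ‖z + 1‖ := by linarith
  rw [hnorm z h0 h1, div_le_iff₀ (Real.rpow_pos_of_pos hpos _)] at hb
  have hup : ‖z + 1‖ ≤ 4 * z.im := by
    refine (Complex.norm_le_abs_re_add_abs_im _).trans ?_
    simp only [Complex.add_re, Complex.one_re, Complex.add_im, Complex.one_im, add_zero]
    rw [abs_of_pos (by linarith), abs_of_pos hy]
    linarith
  have hz : z.im ≤ ‖z‖ := (le_abs_self _).trans (Complex.abs_im_le_norm z)
  have hz' : z.im ≤ ‖z - 1 / 2‖ := by
    have := (le_abs_self _).trans (Complex.abs_im_le_norm (z - 1 / 2))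
    simpa using this
  have hrot : ‖rotatedZeta z‖
      = ‖completedRiemannZeta (2 * z)‖ * Real.exp (Real.pi / 2 * z.im) := by
    have := norm_rotation (Real.pi / 2) z
    push_cast at this
    rw [rotatedZeta, norm_mul, this]
  rw [hrot]
  refine le_of_mul_le_mul_left ?_ (mul_pos hy hy)
  calc z.im * z.im * (‖completedRiemannZeta (2 * z)‖ * Real.exp (Real.pi / 2 * z.im))
      ≤ ‖z‖ * ‖z - 1 / 2‖ * (‖completedRiemannZeta (2 * z)‖ * Real.exp (Real.pi / 2 * z.im)) := by
        gcongr
    _ = ‖z‖ * ‖z - 1 / 2‖ * ‖completedRiemannZeta (2 * z)‖ * Real.exp (Real.pi / 2 * z.im) := by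
        ring
    _ ≤ 36 * C * ‖z + 1‖ ^ (2 + η) := hb
    _ ≤ 36 * C * (4 * z.im) ^ (2 + η) := by gcongr
    _ = z.im * z.im * (36 * C * 4 ^ (2 + η) * z.im ^ η) := by
        rw [Real.mul_rpow (by norm_num) hy.le, Real.rpow_add hy, Real.rpow_two]
        ring

/-! ### The Mellin–Barnes kernel: size and complete vertical integral. -/

/-- The Mellin–Barnes kernel `Γ(z) e^{-iαz} a^{-z}`. -/
noncomputable def saddleKernel (α a : ℝ) (z : ℂ) : ℂ :=
  Complex.Gamma z * Complex.exp (-(α * z * Complex.I)) * (a : ℂ) ^ (-z)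

theorem norm_saddleKernel (α : ℝ) {a : ℝ} (ha : 0 < a) (z : ℂ) :
    ‖saddleKernel α a z‖ = ‖Complex.Gamma z‖ * Real.exp (α * z.im) * a ^ (-z.re) := by
  rw [saddleKernel, norm_mul, norm_mul, norm_rotation, Complex.norm_cpow_eq_rpow_re_of_pos ha,
    Complex.neg_re]

theorem exists_norm_saddleKernel_le :
    ∃ C : ℝ, 0 < C ∧ ∀ α a : ℝ, 0 < a → ∀ z : ℂ, -1 / 2 ≤ z.re → z.re ≤ 5 / 2 → 1 ≤ z.im →
      ‖saddleKernel α a z‖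
        ≤ C * z.im ^ (z.re - 1 / 2) * a ^ (-z.re) * Real.exp (-((Real.pi / 2 - α) * z.im)) := by
  obtain ⟨C, hC, h⟩ := exists_norm_Gamma_le
  refine ⟨C, hC, fun α a ha z h1 h2 h3 => ?_⟩
  rw [norm_saddleKernel α ha]
  calc ‖Complex.Gamma z‖ * Real.exp (α * z.im) * a ^ (-z.re)
      ≤ (C * z.im ^ (z.re - 1 / 2) * Real.exp (-(Real.pi / 2 * z.im))) * Real.exp (α * z.im)
          * a ^ (-z.re) := by
        gcongr
        exact h z h1 h2 h3
    _ = C * z.im ^ (z.re - 1 / 2) * a ^ (-z.re)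
          * (Real.exp (-(Real.pi / 2 * z.im)) * Real.exp (α * z.im)) := by ring
    _ = _ := by
        rw [← Real.exp_add]
        congr 2
        ring

theorem Gamma_differentiableAt_of_im_ne_zero {z : ℂ} (hz : z.im ≠ 0) :
    DifferentiableAt ℂ Complex.Gamma z :=
  Complex.differentiableAt_Gamma z fun m h => hz (by rw [h]; simp)

theorem saddleKernel_differentiableAt (α : ℝ) {a : ℝ} (ha : 0 < a) {z : ℂ} (hz : z.im ≠ 0) :
    DifferentiableAt ℂ (saddleKernel α a) z := by
  have ha' : (a : ℂ) ≠ 0 := by exact_mod_cast ha.ne'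
  have h1 : DifferentiableAt ℂ (fun z : ℂ => (a : ℂ) ^ (-z)) z :=
    differentiableAt_id.neg.const_cpow (Or.inl ha')
  exact ((Gamma_differentiableAt_of_im_ne_zero hz).mul (by fun_prop)).mul h1

/-- The multiplier equals `1` exactly at the saddle point `a e^{iα}`; away from it this recurrence
plays the role of a nonvanishing phase derivative. -/
theorem saddleKernel_add_one (α : ℝ) {a : ℝ} (ha : 0 < a) {z : ℂ} (hz : z ≠ 0) :
    saddleKernel α a (z + 1)
      = z / (a * Complex.exp (α * Complex.I)) * saddleKernel α a z := by
  have ha' : (a : ℂ) ≠ 0 := by exact_mod_cast ha.ne'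
  have h1 : Complex.exp (-(α * (z + 1) * Complex.I))
      = Complex.exp (-(α * z * Complex.I)) * (Complex.exp (α * Complex.I))⁻¹ := by
    rw [← Complex.exp_neg, ← Complex.exp_add]
    congr 1
    ring
  have h2 : (a : ℂ) ^ (-(z + 1)) = (a : ℂ) ^ (-z) * (a : ℂ)⁻¹ := by
    rw [neg_add, Complex.cpow_add _ _ ha', Complex.cpow_neg_one]
  rw [saddleKernel, saddleKernel, Complex.Gamma_add_one _ hz, h1, h2]
  have := Complex.exp_ne_zero (α * Complex.I)
  field_simp

theorem continuous_Gamma_vertical {x : ℝ} (hx : 0 < x) :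
    Continuous fun y : ℝ => Complex.Gamma (x + y * Complex.I) := by
  refine continuous_iff_continuousAt.mpr fun y => ?_
  refine ContinuousAt.comp (f := fun y : ℝ => (x : ℂ) + y * Complex.I) (g := Complex.Gamma)
    (Complex.continuousAt_Gamma _ fun m h => ?_) (by fun_prop)
  have h1 := congrArg Complex.re h
  simp at h1
  have : (0 : ℝ) ≤ m := m.cast_nonneg
  linarith

/-- Joint continuity is what permits the limit `α → π/2` in integrals over bounded segments. -/
theorem continuous_uncurry_saddleKernel {x a : ℝ} (hx : 0 < x) (ha : 0 < a) :
    Continuous (Function.uncurry fun (α y : ℝ) => saddleKernel α a (x + y * Complex.I)) := by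
  have ha' : (a : ℂ) ≠ 0 := by exact_mod_cast ha.ne'
  have h1 : Continuous fun p : ℝ × ℝ => (a : ℂ) ^ (-((x : ℂ) + p.2 * Complex.I)) :=
    Continuous.const_cpow (by fun_prop) (Or.inl ha')
  have h2 : Continuous fun p : ℝ × ℝ => Complex.Gamma (x + p.2 * Complex.I) :=
    (continuous_Gamma_vertical hx).comp continuous_snd
  exact (h2.mul (by fun_prop)).mul h1

theorem continuous_saddleKernel (α : ℝ) {x a : ℝ} (hx : 0 < x) (ha : 0 < a) :
    Continuous fun y : ℝ => saddleKernel α a (x + y * Complex.I) := by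
  have hp : Continuous fun y : ℝ => (α, y) := by fun_prop
  have h := (continuous_uncurry_saddleKernel hx ha).comp hp
  simpa only [Function.comp_def, Function.uncurry_apply_pair] using h

theorem integrable_exp_neg_mul_abs {c : ℝ} (hc : 0 < c) :
    MeasureTheory.Integrable fun y : ℝ => Real.exp (-(c * |y|)) := by
  have h1 : MeasureTheory.IntegrableOn (fun y : ℝ => Real.exp (-(c * |y|))) (Set.Iic 0) := by
    refine (integrableOn_exp_mul_Iic hc 0).congr_fun (fun y hy => ?_) measurableSet_Iic
    simp only [abs_of_nonpos (Set.mem_Iic.mp hy)]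
    congr 1
    ring
  have h2 : MeasureTheory.IntegrableOn (fun y : ℝ => Real.exp (-(c * |y|))) (Set.Ioi 0) := by
    refine (integrableOn_exp_mul_Ioi (neg_lt_zero.mpr hc) 0).congr_fun (fun y hy => ?_)
      measurableSet_Ioi
    simp only [abs_of_pos (Set.mem_Ioi.mp hy)]
    congr 1
    ring
  have := h1.union h2
  rwa [Set.Iic_union_Ioi, MeasureTheory.integrableOn_univ] at this

theorem exists_norm_saddleKernel_vertical_le :
    ∃ C : ℝ, 0 < C ∧ ∀ α a x : ℝ, 0 ≤ α → 0 < a → x ∈ Set.Icc (1 / 2 : ℝ) (3 / 2) → ∀ y : ℝ,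
      ‖saddleKernel α a (x + y * Complex.I)‖
        ≤ C * a ^ (-x) * (1 + |y|) * Real.exp (-(Real.pi / 2 * |y|)) * Real.exp (α * y) := by
  obtain ⟨C, hC, h⟩ := exists_norm_Gamma_le_of_mem_Icc
  refine ⟨C, hC, fun α a x hα ha hx y => ?_⟩
  rw [norm_saddleKernel α ha]
  have hre : ((x : ℂ) + y * Complex.I).re = x := by simp
  have him : ((x : ℂ) + y * Complex.I).im = y := by simp
  rw [hre, him]
  have h1 : (1 + |y|) ^ (x - 1 / 2) ≤ 1 + |y| := by
    calc (1 + |y|) ^ (x - 1 / 2) ≤ (1 + |y|) ^ (1 : ℝ) :=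
          Real.rpow_le_rpow_of_exponent_le (by linarith [abs_nonneg y]) (by linarith [hx.2])
      _ = _ := Real.rpow_one _
  calc ‖Complex.Gamma (x + y * Complex.I)‖ * Real.exp (α * y) * a ^ (-x)
      ≤ (C * (1 + |y|) * Real.exp (-(Real.pi / 2 * |y|))) * Real.exp (α * y) * a ^ (-x) := by
        refine mul_le_mul_of_nonneg_right (mul_le_mul_of_nonneg_right ((h x hx y).trans ?_)
          (Real.exp_pos _).le) (by positivity)
        gcongr
    _ = _ := by ring

theorem integrable_saddleKernel {α a x : ℝ} (hα : 0 ≤ α) (hα' : α < Real.pi / 2) (ha : 0 < a)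
    (hx : x ∈ Set.Icc (1 / 2 : ℝ) (3 / 2)) :
    MeasureTheory.Integrable fun y : ℝ => saddleKernel α a (x + y * Complex.I) := by
  obtain ⟨C, hC, h⟩ := exists_norm_saddleKernel_vertical_le
  -- Half of the available decay absorbs the factor `1 + |y|`; the other half gives integrability.
  set δ := (Real.pi / 2 - α) / 2 with hδ
  have hδ0 : 0 < δ := by rw [hδ]; linarith
  refine ((integrable_exp_neg_mul_abs hδ0).const_mul (C * a ^ (-x) * (1 + 1 / δ))).mono'
    (continuous_saddleKernel α (by linarith [hx.1]) ha).aestronglyMeasurable ?_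
  filter_upwards with y
  refine (h α a x hα ha hx y).trans ?_
  have h1 : 1 + |y| ≤ (1 + 1 / δ) * Real.exp (δ * |y|) := by
    have h2 := Real.add_one_le_exp (δ * |y|)
    have h3 : 1 ≤ Real.exp (δ * |y|) := Real.one_le_exp (by positivity)
    have h4 : |y| = 1 / δ * (δ * |y|) := by field_simp
    have h5 : 1 / δ * (δ * |y|) ≤ 1 / δ * Real.exp (δ * |y|) := by
      gcongr
      linarith
    linarith
  have h6 : α * y ≤ α * |y| := by
    gcongr
    exact le_abs_self y
  calc C * a ^ (-x) * (1 + |y|) * Real.exp (-(Real.pi / 2 * |y|)) * Real.exp (α * y)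
      ≤ C * a ^ (-x) * ((1 + 1 / δ) * Real.exp (δ * |y|)) * Real.exp (-(Real.pi / 2 * |y|))
          * Real.exp (α * |y|) := by gcongr
    _ = C * a ^ (-x) * (1 + 1 / δ) * (Real.exp (δ * |y|) * Real.exp (-(Real.pi / 2 * |y|))
          * Real.exp (α * |y|)) := by ring
    _ = _ := by
        rw [← Real.exp_add, ← Real.exp_add]
        congr 2
        rw [hδ]
        ring

/-- For negative `y` the rotation helps rather than competes with the decay of `Γ`, so the bound is
uniform in `α` up to and including `π/2`. -/
theorem exists_norm_integral_saddleKernel_Iic_le :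
    ∃ C : ℝ, 0 < C ∧ ∀ α a x : ℝ, 0 ≤ α → α ≤ Real.pi / 2 → 0 < a →
      x ∈ Set.Icc (1 / 2 : ℝ) (3 / 2) →
      ‖∫ y in Set.Iic (1 : ℝ), saddleKernel α a (x + y * Complex.I)‖ ≤ C * a ^ (-x) := by
  obtain ⟨C, hC, h⟩ := exists_norm_saddleKernel_vertical_le
  refine ⟨C * (Real.exp (Real.pi / 2) * Real.exp 1) * (Real.exp (1 / 2 * 1) / (1 / 2)),
    by positivity, fun α a x hα hα' ha hx => ?_⟩
  have hpi := Real.pi_gt_three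
  have hb : ‖∫ y in Set.Iic (1 : ℝ), saddleKernel α a (x + y * Complex.I)‖
      ≤ ∫ y in Set.Iic (1 : ℝ), C * a ^ (-x) * (Real.exp (Real.pi / 2) * Real.exp 1)
        * Real.exp (1 / 2 * y) := by
    refine MeasureTheory.norm_integral_le_of_norm_le
      ((integrableOn_exp_mul_Iic (by norm_num) 1).const_mul _) ?_
    filter_upwards [MeasureTheory.ae_restrict_mem measurableSet_Iic] with y hy
    refine (h α a x hα ha hx y).trans ?_
    have hy1 : y ≤ 1 := hy
    have h1 : 1 + |y| ≤ Real.exp |y| := by linarith [Real.add_one_le_exp |y|]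
    calc C * a ^ (-x) * (1 + |y|) * Real.exp (-(Real.pi / 2 * |y|)) * Real.exp (α * y)
        ≤ C * a ^ (-x) * Real.exp |y| * Real.exp (-(Real.pi / 2 * |y|)) * Real.exp (α * y) := by
          gcongr
      _ = C * a ^ (-x) * Real.exp (|y| + -(Real.pi / 2 * |y|) + α * y) := by
          rw [Real.exp_add, Real.exp_add]; ring
      _ ≤ C * a ^ (-x) * Real.exp (Real.pi / 2 + 1 + 1 / 2 * y) := by
          refine mul_le_mul_of_nonneg_left (Real.exp_le_exp.mpr ?_) (by positivity)
          rcases le_total y 0 with h2 | h2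
          · rw [abs_of_nonpos h2]
            nlinarith
          · rw [abs_of_nonneg h2]
            nlinarith
      _ = _ := by rw [Real.exp_add, Real.exp_add]; ring
  refine hb.trans (le_of_eq ?_)
  rw [MeasureTheory.integral_const_mul, integral_exp_mul_Iic (by norm_num)]
  ring

/-- Mellin inversion for the exponential along a rotated ray. -/
theorem integral_saddleKernel {α a x : ℝ} (hα : 0 ≤ α) (hα' : α < Real.pi / 2) (ha : 0 < a)
    (hx : x ∈ Set.Icc (1 / 2 : ℝ) (3 / 2)) :
    ∫ y : ℝ, saddleKernel α a (x + y * Complex.I)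
      = 2 * Real.pi * Complex.exp (-(a * Complex.exp (α * Complex.I))) := by
  have hx0 : 0 < x := by linarith [hx.1]
  set r : ℂ := Complex.exp (α * Complex.I) with hr
  have hrre : 0 < r.re := by
    rw [hr, Complex.exp_ofReal_mul_I_re]
    exact Real.cos_pos_of_mem_Ioo ⟨by linarith, hα'⟩
  set f : ℝ → ℂ := fun u => Complex.exp (-(r * u)) with hf
  have hmellin : ∀ z : ℂ, 0 < z.re →
      mellin f z = Complex.Gamma z * Complex.exp (-(α * z * Complex.I)) := by
    intro z hz
    -- The principal logarithm of `e^{-iα}` is `-iα`, since `|α| < π`.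
    have h1 : (1 / r) ^ z = Complex.exp (-(α * z * Complex.I)) := by
      rw [hr, one_div, ← Complex.exp_neg, Complex.cpow_def_of_ne_zero (Complex.exp_ne_zero _),
        Complex.log_exp]
      · congr 1; ring
      · simp; linarith [Real.pi_pos]
      · simp; linarith [Real.pi_pos]
    rw [mellin]
    simp only [hf, smul_eq_mul]
    rw [integral_cpow_mul_exp_neg_cmul_Ioi hz hrre, h1, mul_comm]
  have hconv : MellinConvergent f x := by
    refine mellinConvergent_of_isBigO_rpow_exp (a := r.re) (b := 0) hrre ?_ ?_ ?_ (by simpa)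
    · exact (Continuous.locallyIntegrable (by fun_prop)).locallyIntegrableOn _
    · refine Asymptotics.IsBigO.of_bound 1 (Filter.Eventually.of_forall fun u => ?_)
      rw [Complex.norm_exp, one_mul, Real.norm_eq_abs, Real.abs_exp]
      simp
    · refine Asymptotics.IsBigO.of_bound 1 ?_
      filter_upwards [self_mem_nhdsWithin] with u hu
      have hu0 : (0 : ℝ) < u := hu
      rw [Complex.norm_exp]
      simp
      positivity
  have hline : ∀ y : ℝ, mellin f (x + y * Complex.I)
      = saddleKernel α 1 (x + y * Complex.I) := by
    intro y
    rw [hmellin _ (by simpa using hx0), saddleKernel]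
    simp
  have hint : Complex.VerticalIntegrable (mellin f) x MeasureTheory.volume := by
    have := integrable_saddleKernel hα hα' one_pos hx
    unfold Complex.VerticalIntegrable
    simpa only [hline] using this
  have hinv := mellinInv_mellin_eq x f ha hconv hint (by fun_prop)
  rw [mellinInv] at hinv
  have hk : ∀ y : ℝ, (a : ℂ) ^ (-((x : ℂ) + y * Complex.I)) • mellin f (x + y * Complex.I)
      = saddleKernel α a (x + y * Complex.I) := by
    intro y
    rw [hmellin _ (by simpa using hx0), saddleKernel, smul_eq_mul, mul_comm]
  simp only [hk] at hinv
  have hr2 : Complex.exp (-(a * r)) = f a := by simp only [hf]; rw [mul_comm]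
  rw [hr2, ← hinv, Complex.real_smul, ← mul_assoc]
  have h1 : (2 * Real.pi : ℂ) * ((1 / (2 * Real.pi) : ℝ) : ℂ) = 1 := by
    have hpi : (Real.pi : ℂ) ≠ 0 := by exact_mod_cast Real.pi_ne_zero
    push_cast
    field_simp
  rw [h1, one_mul]

/-! ### Truncated integrals of the kernel on either side of the saddle point. -/

/-- Comparison of two vertical integrals of a holomorphic function. -/
theorem norm_integral_vertical_sub_le {g : ℂ → ℂ} {x₁ x₂ y₁ y₂ M₁ M₂ : ℝ} (hx : x₁ ≤ x₂)
    (hy : y₁ ≤ y₂)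
    (hg : ∀ z : ℂ, z.re ∈ Set.Icc x₁ x₂ → z.im ∈ Set.Icc y₁ y₂ → DifferentiableAt ℂ g z)
    (h₁ : ∀ x ∈ Set.Icc x₁ x₂, ‖g (x + y₁ * Complex.I)‖ ≤ M₁)
    (h₂ : ∀ x ∈ Set.Icc x₁ x₂, ‖g (x + y₂ * Complex.I)‖ ≤ M₂) :
    ‖(∫ y in y₁..y₂, g (x₂ + y * Complex.I)) - ∫ y in y₁..y₂, g (x₁ + y * Complex.I)‖
      ≤ (x₂ - x₁) * (M₁ + M₂) := by
  have h := Complex.integral_boundary_rect_eq_zero_of_differentiableOn g ⟨x₁, y₁⟩ ⟨x₂, y₂⟩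
    (fun z hz => by
      rw [Set.uIcc_of_le hx, Set.uIcc_of_le hy, Complex.mem_reProdIm] at hz
      exact (hg z hz.1 hz.2).differentiableWithinAt)
  simp only [smul_eq_mul] at h
  set A := ∫ y in y₁..y₂, g (x₂ + y * Complex.I)
  set B := ∫ y in y₁..y₂, g (x₁ + y * Complex.I)
  set D := ∫ x in x₁..x₂, g (x + y₁ * Complex.I)
  set E := ∫ x in x₁..x₂, g (x + y₂ * Complex.I)
  have hAB : A - B = Complex.I * (D - E) := by
    linear_combination (-Complex.I) * h + (A - B) * Complex.I_sq
  have hD : ‖D‖ ≤ M₁ * |x₂ - x₁| :=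
    intervalIntegral.norm_integral_le_of_norm_le_const fun x hx' => by
      rw [Set.uIoc_of_le hx] at hx'
      exact h₁ x ⟨hx'.1.le, hx'.2⟩
  have hE : ‖E‖ ≤ M₂ * |x₂ - x₁| :=
    intervalIntegral.norm_integral_le_of_norm_le_const fun x hx' => by
      rw [Set.uIoc_of_le hx] at hx'
      exact h₂ x ⟨hx'.1.le, hx'.2⟩
  rw [abs_of_nonneg (sub_nonneg.mpr hx)] at hD hE
  rw [hAB, norm_mul, Complex.norm_I, one_mul]
  refine (norm_sub_le _ _).trans ?_
  linarith

/-- Integration of a function that is a unit difference of a holomorphic function, up to a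
remainder `d`. -/
theorem norm_integral_le_of_eq_difference {g : ℂ → ℂ} {F : ℝ → ℂ} {D : ℝ → ℝ}
    {x y₁ y₂ M₁ M₂ : ℝ} (hy : y₁ ≤ y₂)
    (hg : ∀ z : ℂ, z.im ∈ Set.Icc y₁ y₂ → DifferentiableAt ℂ g z)
    (h₁ : ∀ u ∈ Set.Icc x (x + 1), ‖g (u + y₁ * Complex.I)‖ ≤ M₁)
    (h₂ : ∀ u ∈ Set.Icc x (x + 1), ‖g (u + y₂ * Complex.I)‖ ≤ M₂)
    (hF : ContinuousOn F (Set.uIcc y₁ y₂))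
    (hD : IntervalIntegrable D MeasureTheory.volume y₁ y₂)
    (hFD : ∀ y ∈ Set.Icc y₁ y₂,
      ‖F y - (g ((x + 1 : ℝ) + y * Complex.I) - g (x + y * Complex.I))‖ ≤ D y) :
    ‖∫ y in y₁..y₂, F y‖ ≤ M₁ + M₂ + ∫ y in y₁..y₂, D y := by
  have hcont : ∀ u : ℝ, ContinuousOn (fun y : ℝ => g (u + y * Complex.I)) (Set.uIcc y₁ y₂) := by
    intro u y hy'
    rw [Set.uIcc_of_le hy] at hy'
    exact (ContinuousAt.comp (f := fun y : ℝ => (u : ℂ) + y * Complex.I)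
      (hg _ (by simpa using hy')).continuousAt (by fun_prop)).continuousWithinAt
  have hi : ∀ u : ℝ, IntervalIntegrable (fun y : ℝ => g (u + y * Complex.I))
      MeasureTheory.volume y₁ y₂ := fun u => (hcont u).intervalIntegrable
  have hrect := norm_integral_vertical_sub_le (g := g) (x₁ := x) (x₂ := x + 1) (by linarith) hy
    (fun z _ hz => hg z hz) h₁ h₂
  rw [← intervalIntegral.integral_sub (hi _) (hi _), add_sub_cancel_left, one_mul] at hrect
  have hrem := intervalIntegral.norm_integral_le_of_norm_le hy
    (Filter.Eventually.of_forall fun y hy' => hFD y (Set.Ioc_subset_Icc_self hy')) hD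
  rw [intervalIntegral.integral_sub hF.intervalIntegrable ((hi _).sub (hi _))] at hrem
  have h := norm_add_le
    ((∫ y in y₁..y₂, F y) - ∫ y in y₁..y₂, (g ((x + 1 : ℝ) + y * Complex.I)
      - g (x + y * Complex.I)))
    (∫ y in y₁..y₂, (g ((x + 1 : ℝ) + y * Complex.I) - g (x + y * Complex.I)))
  rw [sub_add_cancel] at h
  linarith

theorem saddlePoint_im_le {α a : ℝ} (ha : 0 < a) :
    ((a : ℂ) * Complex.exp (α * Complex.I)).im ≤ a := by
  rw [Complex.im_ofReal_mul, Complex.exp_ofReal_mul_I_im]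
  nlinarith [Real.sin_le_one α]

theorem norm_saddlePoint {α a : ℝ} (ha : 0 < a) :
    ‖(a : ℂ) * Complex.exp (α * Complex.I)‖ = a := by
  rw [norm_mul, Complex.norm_exp_ofReal_mul_I, mul_one, Complex.norm_real, Real.norm_of_nonneg ha.le]

theorem saddlePoint_pi_div_two (a : ℝ) :
    (a : ℂ) * Complex.exp (((Real.pi / 2 : ℝ) : ℂ) * Complex.I) = a * Complex.I := by
  rw [Complex.ofReal_div, Complex.ofReal_ofNat, Complex.exp_pi_div_two_mul_I]

theorem intervalIntegral_div_sub_sq {a p q : ℝ} (hp : p ≤ q) (hq : q < a) (c : ℝ) :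
    IntervalIntegrable (fun y : ℝ => c / (a - y) ^ 2) MeasureTheory.volume p q ∧
      ∫ y in p..q, c / (a - y) ^ 2 = c / (a - q) - c / (a - p) := by
  have hne : ∀ y ∈ Set.uIcc p q, a - y ≠ 0 := by
    intro y hy
    rw [Set.uIcc_of_le hp] at hy
    have := hy.2
    exact ne_of_gt (by linarith)
  have hint : IntervalIntegrable (fun y : ℝ => c / (a - y) ^ 2) MeasureTheory.volume p q :=
    ContinuousOn.intervalIntegrable (ContinuousOn.div (by fun_prop) (by fun_prop)
      fun y hy => pow_ne_zero 2 (hne y hy))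
  refine ⟨hint, ?_⟩
  refine intervalIntegral.integral_eq_sub_of_hasDerivAt (f := fun y => c / (a - y))
    (fun y hy => ?_) hint
  refine ((hasDerivAt_const y c).div ((hasDerivAt_id y).const_sub a) (hne y hy)).congr_deriv ?_
  simp

theorem intervalIntegral_div_sub_sq' {a p q : ℝ} (hp : p ≤ q) (ha : a < p) (c : ℝ) :
    IntervalIntegrable (fun y : ℝ => c / (y - a) ^ 2) MeasureTheory.volume p q ∧
      ∫ y in p..q, c / (y - a) ^ 2 = c / (p - a) - c / (q - a) := by
  have hne : ∀ y ∈ Set.uIcc p q, y - a ≠ 0 := by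
    intro y hy
    rw [Set.uIcc_of_le hp] at hy
    have := hy.1
    exact ne_of_gt (by linarith)
  have hint : IntervalIntegrable (fun y : ℝ => c / (y - a) ^ 2) MeasureTheory.volume p q :=
    ContinuousOn.intervalIntegrable (ContinuousOn.div (by fun_prop) (by fun_prop)
      fun y hy => pow_ne_zero 2 (hne y hy))
  refine ⟨hint, ?_⟩
  have h := intervalIntegral.integral_eq_sub_of_hasDerivAt (f := fun y => -(c / (y - a)))
    (fun y hy => ?_) hint
  · rw [h]; ring
  refine ((hasDerivAt_const y c).div ((hasDerivAt_id y).sub_const a) (hne y hy)).neg.congr_deriv ?_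
  simp
  ring

/-- The left side is the right side times `(y/a)^{x-(1/2+η)}`. This decides the direction of the
unit shift: to the right below the saddle point, to the left above it. -/
theorem rpow_mul_rpow_neg_le {y a η x : ℝ} (hy : 0 < y) (ha : 0 < a)
    (h : (y ≤ a ∧ 1 / 2 + η ≤ x) ∨ (a ≤ y ∧ x ≤ 1 / 2 + η)) :
    y ^ (x - 1 / 2) * a ^ (-x) ≤ y ^ η * a ^ (-(1 / 2 + η)) := by
  have h1 : y ^ (x - 1 / 2) = y ^ η * y ^ (x - (1 / 2 + η)) := by
    rw [← Real.rpow_add hy]; congr 1; ring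
  have h2 : a ^ (-x) = a ^ (-(1 / 2 + η)) * (a ^ (x - (1 / 2 + η)))⁻¹ := by
    rw [← Real.rpow_neg ha.le, ← Real.rpow_add ha]; congr 1; ring
  have h3 : y ^ (x - (1 / 2 + η)) ≤ a ^ (x - (1 / 2 + η)) := by
    rcases h with ⟨h4, h5⟩ | ⟨h4, h5⟩
    · exact Real.rpow_le_rpow hy.le h4 (by linarith)
    · exact Real.rpow_le_rpow_of_nonpos ha h4 (by linarith)
  have h6 : 0 < a ^ (x - (1 / 2 + η)) := Real.rpow_pos_of_pos ha _
  have h7 : y ^ (x - (1 / 2 + η)) * (a ^ (x - (1 / 2 + η)))⁻¹ ≤ 1 := by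
    rw [← div_eq_mul_inv, div_le_one h6]
    exact h3
  rw [h1, h2]
  calc y ^ η * y ^ (x - (1 / 2 + η)) * (a ^ (-(1 / 2 + η)) * (a ^ (x - (1 / 2 + η)))⁻¹)
      = y ^ η * a ^ (-(1 / 2 + η)) * (y ^ (x - (1 / 2 + η)) * (a ^ (x - (1 / 2 + η)))⁻¹) := by ring
    _ ≤ y ^ η * a ^ (-(1 / 2 + η)) * 1 := by gcongr
    _ = _ := mul_one _

/-- First-derivative test below the saddle point, in difference form. -/
theorem exists_norm_integral_saddleKernel_le_of_lt :
    ∃ C : ℝ, 0 < C ∧ ∀ η a Y : ℝ, 0 ≤ η → η ≤ 1 → 1 ≤ Y → Y < a →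
      ‖∫ y in (1 : ℝ)..Y, saddleKernel (Real.pi / 2) a ((1 / 2 + η : ℝ) + y * Complex.I)‖
        ≤ C * (Y ^ η * a ^ (-(1 / 2 + η)) * (a / (a - Y))) := by
  obtain ⟨C, hC, hbd⟩ := exists_norm_saddleKernel_le
  refine ⟨3 * C, by positivity, fun η a Y hη hη' hY hYa => ?_⟩
  have ha : 0 < a := by linarith
  set κ := 1 / 2 + η with hκ
  set k := saddleKernel (Real.pi / 2) a with hk
  set ω : ℂ := a * Complex.I with hω
  have hωn : ‖ω‖ = a := by
    rw [hω, norm_mul, Complex.norm_I, mul_one, Complex.norm_real, Real.norm_of_nonneg ha.le]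
  have hωi : ω.im = a := by simp [hω]
  -- Solving `k(z) = w(z) (k(z+1) - k(z))` with the recurrence gives this `w`; summation by parts
  -- then makes `k` the forward difference of `w k`, up to a difference of `w`.
  set w : ℂ → ℂ := fun z => ω / (z - ω) with hw
  have hsub : ∀ z : ℂ, z.im ≤ Y → a - z.im ≤ ‖z - ω‖ := by
    intro z hz
    have h1 := (neg_le_abs _).trans (Complex.abs_im_le_norm (z - ω))
    rw [Complex.sub_im, hωi] at h1
    linarith
  have hne : ∀ z : ℂ, z.im ≤ Y → z - ω ≠ 0 := fun z hz => norm_pos_iff.mp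
    (lt_of_lt_of_le (by linarith) (hsub z hz))
  have hwn : ∀ z : ℂ, z.im ≤ Y → ‖w z‖ ≤ a / (a - z.im) := by
    intro z hz
    rw [hw]
    simp only
    rw [norm_div, hωn]
    have := hsub z hz
    gcongr
    linarith
  set P := Y ^ η * a ^ (-κ) with hP
  have hP0 : 0 ≤ P := by rw [hP]; positivity
  have hkn : ∀ z : ℂ, κ ≤ z.re → z.re ≤ κ + 1 → 1 ≤ z.im → z.im ≤ Y → ‖k z‖ ≤ C * P := by
    intro z h1 h2 h3 h4
    have h5 := hbd (Real.pi / 2) a ha z (by linarith) (by linarith) h3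
    rw [sub_self, zero_mul, neg_zero, Real.exp_zero, mul_one, mul_assoc] at h5
    refine h5.trans ?_
    gcongr
    refine (rpow_mul_rpow_neg_le (by linarith) ha (Or.inl ⟨by linarith, h1⟩)).trans ?_
    rw [hP]
    gcongr
  set g : ℂ → ℂ := fun z => w z * k z with hg
  have hkd : ∀ z : ℂ, 1 ≤ z.im → DifferentiableAt ℂ k z := fun z hz =>
    saddleKernel_differentiableAt _ ha (by linarith)
  have hwd : ∀ z : ℂ, z.im ≤ Y → DifferentiableAt ℂ w z := fun z hz =>
    (differentiableAt_const ω).div (differentiableAt_id.sub_const ω) (hne z hz)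
  have hedge : ∀ y : ℝ, 1 ≤ y → y ≤ Y → ∀ x ∈ Set.Icc κ (κ + 1),
      ‖g (x + y * Complex.I)‖ ≤ a / (a - Y) * (C * P) := by
    intro y h1 h2 x hx
    have hre : ((x : ℂ) + y * Complex.I).re = x := by simp
    have him : ((x : ℂ) + y * Complex.I).im = y := by simp
    rw [hg]
    simp only
    rw [norm_mul]
    have h3 := hwn (x + y * Complex.I) (by rw [him]; exact h2)
    rw [him] at h3
    have h4 := hkn (x + y * Complex.I) (by rw [hre]; exact hx.1) (by rw [hre]; exact hx.2)
      (by rwa [him]) (by rwa [him])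
    have h5 : 0 < a - Y := by linarith
    gcongr
    exact h3.trans (by gcongr)
  have hident : ∀ z : ℂ, 1 ≤ z.im → z.im ≤ Y →
      k z = g (z + 1) - g z + (w z - w (z + 1)) * k (z + 1) := by
    intro z h1 h2
    have hz0 : z ≠ 0 := by rintro rfl; simp at h1; linarith
    have hrec : k (z + 1) = z / ω * k z := by
      rw [hk, saddleKernel_add_one _ ha hz0, saddlePoint_pi_div_two]
    have hω0 : ω ≠ 0 := norm_pos_iff.mp (by rw [hωn]; exact ha)
    have h3 := hne z h2
    have h4 : w z * (k (z + 1) - k z) = k z := by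
      rw [hrec, hw]
      field_simp
    rw [hg]
    linear_combination -h4
  have hdiff : ∀ z : ℂ, z.im ≤ Y → ‖w z - w (z + 1)‖ ≤ a / (a - z.im) ^ 2 := by
    intro z hz
    have h1 := hne z hz
    have h2 := hne (z + 1) (by simpa using hz)
    have h3 : w z - w (z + 1) = ω / ((z - ω) * (z + 1 - ω)) := by
      rw [hw]
      simp only
      rw [div_sub_div _ _ h1 h2]
      congr 1
      ring
    have h4 := hsub z hz
    have h5 := hsub (z + 1) (by simpa using hz)
    rw [Complex.add_im, Complex.one_im, add_zero] at h5
    have h6 : 0 < a - z.im := by linarith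
    rw [h3, norm_div, hωn, norm_mul, sq]
    gcongr
  obtain ⟨hI, hv⟩ := intervalIntegral_div_sub_sq hY hYa (C * P * a)
  have hcont : ContinuousOn (fun y : ℝ => k (κ + y * Complex.I)) (Set.uIcc 1 Y) :=
    (continuous_saddleKernel _ (by linarith) ha).continuousOn
  have h := norm_integral_le_of_eq_difference (g := g) hY
    (fun z hz => (hwd z hz.2).mul (hkd z hz.1)) (hedge 1 le_rfl hY) (hedge Y hY le_rfl) hcont hI
    fun y hy => ?_
  · refine h.trans ?_
    rw [hv]
    have h1 : 0 ≤ C * P * a / (a - 1) := div_nonneg (by positivity) (by linarith)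
    have h2 : C * P * a / (a - Y) = C * P * (a / (a - Y)) := by ring
    linarith
  · have he : ((κ + 1 : ℝ) : ℂ) + y * Complex.I = (κ + y * Complex.I) + 1 := by push_cast; ring
    have him : ((κ : ℂ) + y * Complex.I).im = y := by simp
    have h1 := hdiff (κ + y * Complex.I) (by rw [him]; exact hy.2)
    have h2 := hkn ((κ + 1 : ℝ) + y * Complex.I) (by simp) (by simp) (by simpa using hy.1)
      (by simpa using hy.2)
    rw [him] at h1
    rw [he] at h2 ⊢
    rw [hident _ (by rw [him]; exact hy.1) (by rw [him]; exact hy.2), add_sub_cancel_left,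
      norm_mul, mul_div_assoc, mul_comm]
    gcongr

/-- First-derivative test above the saddle point, in difference form. -/
theorem exists_norm_integral_saddleKernel_le_of_gt :
    ∃ C : ℝ, 0 < C ∧ ∀ α η a Y Y' : ℝ, α ≤ Real.pi / 2 → 0 ≤ η → η ≤ 1 → 0 < a → 1 ≤ Y →
      a < Y → Y ≤ Y' →
      ‖∫ y in Y..Y', saddleKernel α a ((1 / 2 + η : ℝ) + y * Complex.I)‖
        ≤ C * (a ^ (-(1 / 2 + η)) * (Y / (Y - a)))
          * (Y ^ η + Y' ^ η * Real.exp (-((Real.pi / 2 - α) * Y'))) := by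
  obtain ⟨C, hC, hbd⟩ := exists_norm_saddleKernel_le
  refine ⟨5 * C, by positivity, fun α η a Y Y' hα hη hη' ha hY haY hYY' => ?_⟩
  set κ := 1 / 2 + η with hκ
  set k := saddleKernel α a with hk
  set ω : ℂ := a * Complex.exp (α * Complex.I) with hω
  have hωn : ‖ω‖ = a := norm_saddlePoint ha
  have hωi : ω.im ≤ a := saddlePoint_im_le ha
  have hω0 : ω ≠ 0 := norm_pos_iff.mp (by rw [hωn]; exact ha)
  -- The backward analogue: `w` solves `k(z) = w(z) (k(z) - k(z-1))`.
  set w : ℂ → ℂ := fun z => (z - 1) / (z - 1 - ω) with hw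
  have hsub : ∀ z : ℂ, z.im - a ≤ ‖z - ω‖ := by
    intro z
    have h1 := (le_abs_self _).trans (Complex.abs_im_le_norm (z - ω))
    rw [Complex.sub_im] at h1
    linarith
  have hne : ∀ z : ℂ, Y ≤ z.im → z - ω ≠ 0 := fun z hz => norm_pos_iff.mp
    (lt_of_lt_of_le (by linarith) (hsub z))
  set A := a ^ (-κ) with hA
  have hA0 : 0 < A := Real.rpow_pos_of_pos ha _
  have hkn : ∀ z : ℂ, -1 / 2 ≤ z.re → z.re ≤ κ → Y ≤ z.im →
      ‖k z‖ ≤ C * (z.im ^ η * A) * Real.exp (-((Real.pi / 2 - α) * z.im)) := by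
    intro z h1 h2 h3
    refine (hbd α a ha z h1 (by linarith) (by linarith)).trans ?_
    rw [mul_assoc C]
    exact mul_le_mul_of_nonneg_right (mul_le_mul_of_nonneg_left
      (rpow_mul_rpow_neg_le (by linarith) ha (Or.inr ⟨by linarith, h2⟩)) hC.le) (Real.exp_pos _).le
  set g : ℂ → ℂ := fun z => w z * k z with hg
  have hkd : ∀ z : ℂ, Y ≤ z.im → DifferentiableAt ℂ k z := fun z hz =>
    saddleKernel_differentiableAt _ ha (by linarith)
  have hne1 : ∀ z : ℂ, Y ≤ z.im → z - 1 - ω ≠ 0 := fun z hz => hne (z - 1) (by simpa using hz)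
  have hwd : ∀ z : ℂ, Y ≤ z.im → DifferentiableAt ℂ w z := fun z hz =>
    (differentiableAt_id.sub_const 1).div ((differentiableAt_id.sub_const 1).sub_const ω)
      (hne1 z hz)
  have hedge : ∀ y : ℝ, Y ≤ y → ∀ x ∈ Set.Icc (κ - 1) (κ - 1 + 1),
      ‖g (x + y * Complex.I)‖
        ≤ 4 * C * (A * (Y / (Y - a))) * (y ^ η * Real.exp (-((Real.pi / 2 - α) * y))) := by
    intro y h1 x hx
    have hre : ((x : ℂ) + y * Complex.I).re = x := by simp
    have him : ((x : ℂ) + y * Complex.I).im = y := by simp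
    set z := (x : ℂ) + y * Complex.I with hz
    have hz1 : ‖z - 1‖ ≤ 4 * y := by
      refine (Complex.norm_le_abs_re_add_abs_im _).trans ?_
      rw [Complex.sub_re, Complex.sub_im, hre, him, Complex.one_re, Complex.one_im, sub_zero,
        abs_of_pos (show 0 < y by linarith)]
      have : |x - 1| ≤ 2 := abs_le.mpr ⟨by linarith [hx.1], by linarith [hx.2]⟩
      linarith
    have h2 : y - a ≤ ‖z - 1 - ω‖ := by
      have := hsub (z - 1)
      rwa [Complex.sub_im, Complex.one_im, sub_zero, him] at this
    have h3 : 0 < Y - a := by linarith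
    have h4 : ‖w z‖ ≤ 4 * (Y / (Y - a)) := by
      rw [hw]
      simp only
      rw [norm_div]
      calc ‖z - 1‖ / ‖z - 1 - ω‖ ≤ 4 * y / (y - a) :=
            div_le_div₀ (by linarith) hz1 (by linarith) h2
        _ ≤ 4 * (Y / (Y - a)) := by
            rw [mul_div_assoc]
            gcongr 4 * ?_
            rw [div_le_div_iff₀ (by linarith) h3]
            nlinarith
    have h5 := hkn z (by rw [hre]; linarith [hx.1]) (by rw [hre]; linarith [hx.2])
      (by rwa [him])
    rw [him] at h5
    rw [hg]
    simp only
    rw [norm_mul]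
    calc ‖w z‖ * ‖k z‖ ≤ (4 * (Y / (Y - a)))
          * (C * (y ^ η * A) * Real.exp (-((Real.pi / 2 - α) * y))) := by gcongr
      _ = _ := by ring
  have hident : ∀ z : ℂ, Y ≤ z.im → k z = g z - g (z - 1) + (w (z - 1) - w z) * k (z - 1) := by
    intro z h1
    have hz0 : z - 1 ≠ 0 := by
      intro h0
      have := congrArg Complex.im h0
      simp at this
      linarith
    have hrec : k z = (z - 1) / ω * k (z - 1) := by
      rw [hk, ← saddleKernel_add_one _ ha hz0, sub_add_cancel]
    have h3 := hne1 z h1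
    have h4 : w z * (k z - k (z - 1)) = k z := by
      rw [hrec, hw]
      field_simp
    rw [hg]
    linear_combination -h4
  have hdiff : ∀ z : ℂ, Y ≤ z.im → ‖w (z - 1) - w z‖ ≤ a / (z.im - a) ^ 2 := by
    intro z hz
    have h1 := hne1 z hz
    have h2 := hne1 (z - 1) (by simpa using hz)
    have h3 : w (z - 1) - w z = ω / ((z - 1 - 1 - ω) * (z - 1 - ω)) := by
      rw [hw]
      simp only
      rw [div_sub_div _ _ h2 h1]
      congr 1
      ring
    have h4 := hsub (z - 1)
    have h5 := hsub (z - 1 - 1)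
    simp only [Complex.sub_im, Complex.one_im, sub_zero] at h4 h5
    have h6 : 0 < z.im - a := by linarith
    rw [h3, norm_div, hωn, norm_mul, sq]
    gcongr
  set R := C * (Y ^ η * A) * Y with hR
  obtain ⟨hI, hv⟩ := intervalIntegral_div_sub_sq' hYY' haY R
  have hcont : ContinuousOn (fun y : ℝ => k (κ + y * Complex.I)) (Set.uIcc Y Y') :=
    (continuous_saddleKernel _ (by linarith) ha).continuousOn
  have hE : ∀ y : ℝ, Y ≤ y → Real.exp (-((Real.pi / 2 - α) * y)) ≤ 1 := fun y hy => by
    rw [Real.exp_le_one_iff]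
    have := mul_nonneg (sub_nonneg.mpr hα) (show 0 ≤ y by linarith)
    linarith
  have h := norm_integral_le_of_eq_difference (g := g) hYY'
    (fun z hz => (hwd z hz.1).mul (hkd z hz.1)) (hedge Y le_rfl) (hedge Y' hYY') hcont hI
    fun y hy => ?_
  · refine h.trans ?_
    rw [hv]
    have h0 : 0 < Y - a := by linarith
    have hY' : 0 < Y' := by linarith
    have h1 : 0 ≤ R / (Y' - a) := div_nonneg (by rw [hR]; positivity) (by linarith)
    have h2 : R / (Y - a) = C * (A * (Y / (Y - a))) * Y ^ η := by rw [hR]; ring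
    have h3 : 4 * C * (A * (Y / (Y - a))) * (Y ^ η * Real.exp (-((Real.pi / 2 - α) * Y)))
        ≤ 4 * C * (A * (Y / (Y - a))) * (Y ^ η * 1) := by
      gcongr
      exact hE Y le_rfl
    have h4 : 0 ≤ C * (A * (Y / (Y - a)))
        * (Y' ^ η * Real.exp (-((Real.pi / 2 - α) * Y'))) := by positivity
    linarith
  · have he : ((κ - 1 : ℝ) : ℂ) + y * Complex.I = (κ + y * Complex.I) - 1 := by push_cast; ring
    have him : ((κ : ℂ) + y * Complex.I).im = y := by simp
    have h1 := hdiff (κ + y * Complex.I) (by rw [him]; exact hy.1)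
    rw [him] at h1
    have hy0 : 0 < y := by linarith [hy.1]
    -- On the shifted line the exponent of `y` is `η - 1 ≤ 0`, so `y` may be replaced by its least
    -- value `Y`; this keeps the remainder independent of `Y'`.
    have h2 : ‖k ((κ - 1 : ℝ) + y * Complex.I)‖ ≤ C * (Y ^ η * A) := by
      have h3 := hbd α a ha ((κ - 1 : ℝ) + y * Complex.I) (by simp; linarith) (by simp; linarith)
        (by simp; linarith [hy.1])
      have hre' : (((κ - 1 : ℝ) : ℂ) + y * Complex.I).re = κ - 1 := by simp
      have him' : (((κ - 1 : ℝ) : ℂ) + y * Complex.I).im = y := by simp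
      rw [hre', him'] at h3
      refine h3.trans ?_
      calc C * y ^ (κ - 1 - 1 / 2) * a ^ (-(κ - 1)) * Real.exp (-((Real.pi / 2 - α) * y))
          ≤ C * Y ^ (κ - 1 - 1 / 2) * a ^ (-(κ - 1)) * 1 := by
            have h5 : y ^ (κ - 1 - 1 / 2) ≤ Y ^ (κ - 1 - 1 / 2) :=
              Real.rpow_le_rpow_of_nonpos (by linarith) hy.1 (by linarith)
            have h6 := hE y hy.1
            gcongr
        _ = C * (Y ^ (κ - 1 - 1 / 2) * a ^ (-(κ - 1))) := by ring
        _ ≤ C * (Y ^ η * A) := mul_le_mul_of_nonneg_left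
            (rpow_mul_rpow_neg_le (by linarith) ha (Or.inr ⟨haY.le, by linarith⟩)) hC.le
    rw [sub_add_cancel, he, hident _ (by rw [him]; exact hy.1), add_sub_cancel_left,
      norm_mul, mul_comm, hR, mul_div_assoc]
    rw [he] at h2
    have h5 : a / (y - a) ^ 2 ≤ Y / (y - a) ^ 2 := by gcongr
    exact mul_le_mul h2 (h1.trans h5) (norm_nonneg _) (by positivity)

/-- Saddle point evaluation above the saddle point. -/
theorem exists_norm_integral_saddleKernel_sub_le :
    ∃ C : ℝ, 0 < C ∧ ∀ η a Y : ℝ, 0 ≤ η → η ≤ 1 → 0 < a → 1 ≤ Y → a < Y →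
      ‖(∫ y in (1 : ℝ)..Y, saddleKernel (Real.pi / 2) a ((1 / 2 + η : ℝ) + y * Complex.I))
          - 2 * Real.pi * Complex.exp (-(a * Complex.I))‖
        ≤ C * (Y ^ η * a ^ (-(1 / 2 + η)) * (Y / (Y - a))) := by
  obtain ⟨C₁, hC₁, h₁⟩ := exists_norm_integral_saddleKernel_Iic_le
  obtain ⟨C₂, hC₂, h₂⟩ := exists_norm_integral_saddleKernel_le_of_gt
  refine ⟨C₁ + C₂, by positivity, fun η a Y hη hη' ha hY haY => ?_⟩
  set κ := 1 / 2 + η with hκ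
  have hκ' : κ ∈ Set.Icc (1 / 2 : ℝ) (3 / 2) := ⟨by linarith, by linarith⟩
  have hκ0 : 0 < κ := by linarith
  set Q := a ^ (-κ) * (Y / (Y - a)) with hQ
  have hQ0 : 0 < Q := by
    have : 0 < Y - a := by linarith
    rw [hQ]; positivity
  have hmain : ∀ α ∈ Set.Ico 0 (Real.pi / 2),
      ‖(∫ y in (1 : ℝ)..Y, saddleKernel α a (κ + y * Complex.I))
        - 2 * Real.pi * Complex.exp (-(a * Complex.exp (α * Complex.I)))‖
      ≤ C₁ * a ^ (-κ) + C₂ * Q * Y ^ η := by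
    intro α hα
    have hint := integrable_saddleKernel hα.1 hα.2 ha hκ'
    have htail : ‖∫ y in Set.Ioi Y, saddleKernel α a (κ + y * Complex.I)‖ ≤ C₂ * Q * Y ^ η := by
      have hδ : 0 < Real.pi / 2 - α := by linarith [hα.2]
      -- For `α < π/2` the contribution of the upper end `Y'` decays exponentially, which leaves a
      -- tail bound uniform in `α`.
      have hlim : Filter.Tendsto (fun Y' : ℝ => C₂ * Q
          * (Y ^ η + Y' ^ η * Real.exp (-((Real.pi / 2 - α) * Y')))) Filter.atTop
          (nhds (C₂ * Q * (Y ^ η + 0))) := by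
        have h := tendsto_rpow_mul_exp_neg_mul_atTop_nhds_zero η _ hδ
        simp only [neg_mul] at h
        exact (h.const_add _).const_mul _
      rw [add_zero] at hlim
      refine le_of_tendsto_of_tendsto (MeasureTheory.intervalIntegral_tendsto_integral_Ioi Y
        hint.integrableOn Filter.tendsto_id).norm hlim ?_
      filter_upwards [Filter.eventually_ge_atTop Y] with Y' hY'
      exact h₂ α η a Y Y' hα.2.le hη hη' ha hY haY hY'
    have hsplit : (∫ y in (1 : ℝ)..Y, saddleKernel α a (κ + y * Complex.I))
        - 2 * Real.pi * Complex.exp (-(a * Complex.exp (α * Complex.I)))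
        = -(∫ y in Set.Iic (1 : ℝ), saddleKernel α a (κ + y * Complex.I))
          - ∫ y in Set.Ioi Y, saddleKernel α a (κ + y * Complex.I) := by
      rw [← integral_saddleKernel hα.1 hα.2 ha hκ',
        ← intervalIntegral.integral_Iic_sub_Iic hint.integrableOn hint.integrableOn,
        ← intervalIntegral.integral_Iic_add_Ioi (b := Y) hint.integrableOn hint.integrableOn]
      ring
    rw [hsplit]
    refine (norm_sub_le _ _).trans ?_
    rw [norm_neg]
    exact add_le_add (h₁ α a κ hα.1 hα.2.le ha hκ') htail
  -- At `α = π/2` the complete integral need not converge absolutely, but the truncated one is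
  -- continuous in `α`, so the uniform bound passes to the limit.
  have hcont : Continuous fun α : ℝ => ‖(∫ y in (1 : ℝ)..Y, saddleKernel α a (κ + y * Complex.I))
        - 2 * Real.pi * Complex.exp (-(a * Complex.exp (α * Complex.I)))‖ :=
    ((intervalIntegral.continuous_parametric_intervalIntegral_of_continuous'
      (continuous_uncurry_saddleKernel hκ0 ha) 1 Y).sub (by fun_prop)).norm
  have hpi : ‖(∫ y in (1 : ℝ)..Y, saddleKernel (Real.pi / 2) a (κ + y * Complex.I))
      - 2 * Real.pi * Complex.exp (-(a * Complex.exp (((Real.pi / 2 : ℝ) : ℂ) * Complex.I)))‖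
      ≤ C₁ * a ^ (-κ) + C₂ * Q * Y ^ η := by
    refine le_of_tendsto (hcont.continuousWithinAt (s := Set.Iio (Real.pi / 2))
      (x := Real.pi / 2)) ?_
    filter_upwards [Ico_mem_nhdsLT (show (0 : ℝ) < Real.pi / 2 by positivity)] with α hα
    exact hmain α hα
  rw [saddlePoint_pi_div_two] at hpi
  refine hpi.trans ?_
  have h3 : a ^ (-κ) * 1 * 1 ≤ a ^ (-κ) * (Y / (Y - a)) * Y ^ η := by
    have h4 : 0 < Y - a := by linarith
    gcongr
    · rw [one_le_div h4]; linarith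
    · exact Real.one_le_rpow hY hη
  rw [mul_one, mul_one] at h3
  calc C₁ * a ^ (-κ) + C₂ * Q * Y ^ η ≤ C₁ * (Q * Y ^ η) + C₂ * Q * Y ^ η := by gcongr
    _ = _ := by rw [hQ]; ring

/-! ### The terms of the rotated Dirichlet series, `a = πn²`. -/

/-- This is the source of the alternating sign: `n²` and `n` have the same parity. -/
theorem exp_neg_pi_mul_sq_mul_I (n : ℕ) :
    Complex.exp (-(((Real.pi * (n : ℝ) ^ 2 : ℝ) : ℂ) * Complex.I)) = (-1) ^ n := by
  have h1 : -(((Real.pi * (n : ℝ) ^ 2 : ℝ) : ℂ) * Complex.I)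
      = ((n ^ 2 : ℕ) : ℂ) * (-(Real.pi * Complex.I)) := by
    push_cast
    ring
  rw [h1, Complex.exp_nat_mul, Complex.exp_neg, Complex.exp_pi_mul_I, inv_neg, inv_one]
  rcases Nat.even_or_odd n with h | h
  · rw [h.neg_one_pow, (h.pow_of_ne_zero two_ne_zero).neg_one_pow]
  · rw [h.neg_one_pow, h.pow.neg_one_pow]

theorem rpow_neg_pi_mul_sq_le {n : ℕ} (hn : 0 < n) {η : ℝ} (hη : 0 ≤ η) :
    (Real.pi * (n : ℝ) ^ 2) ^ (-(1 / 2 + η)) ≤ (n : ℝ) ^ (-(1 + 2 * η)) := by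
  have hn' : (0 : ℝ) < n := by exact_mod_cast hn
  have h1 : (n : ℝ) ^ (-(1 + 2 * η)) = ((n : ℝ) ^ 2) ^ (-(1 / 2 + η)) := by
    rw [← Real.rpow_two, ← Real.rpow_mul hn'.le]
    congr 1
    ring
  rw [h1]
  refine Real.rpow_le_rpow_of_nonpos (by positivity) ?_ (by linarith)
  nlinarith [Real.pi_gt_three, sq_nonneg (n : ℝ)]

/-- The rotated Dirichlet series of the zeta function. -/
theorem hasSum_saddleKernel {z : ℂ} (hz : 1 / 2 < z.re) :
    HasSum (fun n : ℕ => saddleKernel (Real.pi / 2) (Real.pi * (n : ℝ) ^ 2) z)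
      (rotatedZeta z) := by
  have hz0 : z ≠ 0 := by rintro rfl; simp at hz; linarith
  have hre : 1 < (2 * z).re := by simp; linarith
  have hs : Summable fun n : ℕ => 1 / (n : ℂ) ^ (2 * z) :=
    Complex.summable_one_div_nat_cpow.mpr hre
  have h1 := hs.hasSum.mul_left (Complex.Gamma z * Complex.exp (-(((Real.pi / 2 : ℝ) : ℂ) * z
    * Complex.I)) * (Real.pi : ℂ) ^ (-z))
  have h2 : rotatedZeta z = Complex.Gamma z * Complex.exp (-(((Real.pi / 2 : ℝ) : ℂ) * z
      * Complex.I)) * (Real.pi : ℂ) ^ (-z) * ∑' n : ℕ, 1 / (n : ℂ) ^ (2 * z) := by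
    rw [rotatedZeta, completedZeta_eq_tsum_of_one_lt_re hre, mul_div_cancel_left₀ z two_ne_zero,
      show -(2 * z) / 2 = -z by ring]
    push_cast
    ring
  rw [h2]
  refine h1.congr_fun fun n => ?_
  rw [saddleKernel, mul_assoc _ ((Real.pi : ℂ) ^ (-z))]
  congr 1
  rcases Nat.eq_zero_or_pos n with rfl | hn
  · have h3 : (2 * z) ≠ 0 := mul_ne_zero two_ne_zero hz0
    simp [Complex.zero_cpow h3, Complex.zero_cpow (neg_ne_zero.mpr hz0)]
  · have hn' : (n : ℂ) ≠ 0 := by exact_mod_cast hn.ne'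
    have h4 : ((Real.pi * (n : ℝ) ^ 2 : ℝ) : ℂ) ^ (-z)
        = (Real.pi : ℂ) ^ (-z) * (((n : ℝ) : ℂ) ^ (-z) * ((n : ℝ) : ℂ) ^ (-z)) := by
      rw [sq, Complex.ofReal_mul, Complex.ofReal_mul,
        ← Complex.mul_cpow_ofReal_nonneg n.cast_nonneg n.cast_nonneg, ← Complex.ofReal_mul,
        ← Complex.mul_cpow_ofReal_nonneg Real.pi_pos.le (by positivity)]
    rw [h4, Complex.ofReal_natCast, ← Complex.cpow_add _ _ hn', one_div, ← Complex.cpow_neg]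
    congr 2
    ring

/-- By the convention `0 ^ w = 0` for `w ≠ 0`, the index `n = 0` contributes nothing and the series
may run over all of `ℕ`. -/
theorem saddleKernel_zero (α : ℝ) {z : ℂ} (hz : z ≠ 0) : saddleKernel α 0 z = 0 := by
  rw [saddleKernel, Complex.ofReal_zero, Complex.zero_cpow (neg_ne_zero.mpr hz), mul_zero]

theorem vertical_ne_zero {x : ℝ} (hx : 0 < x) (y : ℝ) : (x : ℂ) + y * Complex.I ≠ 0 :=
  norm_pos_iff.mp (norm_ofReal_add_mul_I_pos hx y)

theorem exists_norm_saddleKernel_sq_le :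
    ∃ C : ℝ, 0 < C ∧ ∀ η : ℝ, 0 ≤ η → η ≤ 1 → ∀ n : ℕ, 0 < n → ∀ y : ℝ, 1 ≤ y →
      ‖saddleKernel (Real.pi / 2) (Real.pi * (n : ℝ) ^ 2) ((1 / 2 + η : ℝ) + y * Complex.I)‖
        ≤ C * y ^ η * (n : ℝ) ^ (-(1 + 2 * η)) := by
  obtain ⟨C, hC, h⟩ := exists_norm_saddleKernel_le
  refine ⟨C, hC, fun η hη hη' n hn y hy => ?_⟩
  have hn' : (0 : ℝ) < n := by exact_mod_cast hn
  have hre : (((1 / 2 + η : ℝ) : ℂ) + y * Complex.I).re = 1 / 2 + η := by simp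
  have him : (((1 / 2 + η : ℝ) : ℂ) + y * Complex.I).im = y := by simp
  have h1 := h (Real.pi / 2) (Real.pi * (n : ℝ) ^ 2) (by positivity)
    ((1 / 2 + η : ℝ) + y * Complex.I) (by rw [hre]; linarith) (by rw [hre]; linarith)
    (by rw [him]; exact hy)
  rw [hre, him, sub_self, zero_mul, neg_zero, Real.exp_zero, mul_one, add_sub_cancel_left] at h1
  refine h1.trans ?_
  gcongr
  exact rpow_neg_pi_mul_sq_le hn hη

/-- Dominated convergence with majorant `Y^η n^{-1-2η}`; its summability requires `η > 0`, the
reason for leaving the line `Re z = 1/2`. -/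
theorem hasSum_integral_saddleKernel {η : ℝ} (hη : 0 < η) (hη' : η ≤ 1) {Y : ℝ} (hY : 1 ≤ Y) :
    HasSum (fun n : ℕ => ∫ y in (1 : ℝ)..Y,
        saddleKernel (Real.pi / 2) (Real.pi * (n : ℝ) ^ 2) ((1 / 2 + η : ℝ) + y * Complex.I))
      (∫ y in (1 : ℝ)..Y, rotatedZeta ((1 / 2 + η : ℝ) + y * Complex.I)) := by
  obtain ⟨C, hC, h⟩ := exists_norm_saddleKernel_sq_le
  have hκ : 0 < 1 / 2 + η := by linarith
  have hsum : Summable fun n : ℕ => C * Y ^ η * (n : ℝ) ^ (-(1 + 2 * η)) :=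
    (Real.summable_nat_rpow.mpr (by linarith)).mul_left _
  refine intervalIntegral.hasSum_integral_of_dominated_convergence
    (fun n _ => C * Y ^ η * (n : ℝ) ^ (-(1 + 2 * η))) (fun n => ?_) (fun n => ?_)
    (Filter.Eventually.of_forall fun _ _ => hsum) intervalIntegrable_const ?_
  · rcases Nat.eq_zero_or_pos n with rfl | hn
    · simp only [Nat.cast_zero, ne_eq, OfNat.ofNat_ne_zero, not_false_eq_true, zero_pow, mul_zero,
        saddleKernel_zero _ (vertical_ne_zero hκ _)]
      exact MeasureTheory.aestronglyMeasurable_const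
    · have hn' : (0 : ℝ) < n := by exact_mod_cast hn
      exact (continuous_saddleKernel _ hκ (by positivity)).aestronglyMeasurable
  · refine Filter.Eventually.of_forall fun y hy => ?_
    rw [Set.uIoc_of_le hY] at hy
    rcases Nat.eq_zero_or_pos n with rfl | hn
    · simp only [Nat.cast_zero, ne_eq, OfNat.ofNat_ne_zero, not_false_eq_true, zero_pow, mul_zero,
        saddleKernel_zero _ (vertical_ne_zero hκ _), norm_zero]
      positivity
    · refine (h η hη.le hη' n hn y hy.1.le).trans ?_
      have := hy.1
      have := hy.2
      gcongr
  · refine Filter.Eventually.of_forall fun y _ => hasSum_saddleKernel ?_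
    simp
    linarith

/-- With `Y = πX²` the factor `Y/(Y-a)` is `X²/(X²-n²)`, which is at most `X/(X-n)`. -/
theorem exists_norm_integral_saddleKernel_sq_sub_le :
    ∃ C : ℝ, 0 < C ∧ ∀ η X : ℝ, 0 ≤ η → η ≤ 1 → ∀ n : ℕ, 0 < n → n < X →
      ‖(∫ y in (1 : ℝ)..Real.pi * X ^ 2, saddleKernel (Real.pi / 2) (Real.pi * (n : ℝ) ^ 2)
          ((1 / 2 + η : ℝ) + y * Complex.I)) - 2 * Real.pi * (-1) ^ n‖
        ≤ C * ((Real.pi * X ^ 2) ^ η * (n : ℝ) ^ (-(1 + 2 * η)) * (X / (X - n))) := by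
  obtain ⟨C, hC, h⟩ := exists_norm_integral_saddleKernel_sub_le
  refine ⟨C, hC, fun η X hη hη' n hn hnX => ?_⟩
  have hn' : (1 : ℝ) ≤ n := by exact_mod_cast hn
  have hX : 0 < X := by linarith
  have hpi := Real.pi_gt_three
  have hlt : Real.pi * (n : ℝ) ^ 2 < Real.pi * X ^ 2 := by gcongr
  have h1 := h η (Real.pi * (n : ℝ) ^ 2) (Real.pi * X ^ 2) hη hη' (by positivity)
    (by nlinarith) hlt
  rw [exp_neg_pi_mul_sq_mul_I] at h1
  refine h1.trans ?_
  have h2 : Real.pi * X ^ 2 / (Real.pi * X ^ 2 - Real.pi * (n : ℝ) ^ 2) ≤ X / (X - n) := by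
    rw [div_le_div_iff₀ (by linarith) (by linarith)]
    have : 0 ≤ Real.pi * X * (n * (X - n)) := by
      have := sub_nonneg.mpr hnX.le
      positivity
    nlinarith
  have h3 : 0 ≤ X / (X - n) := div_nonneg hX.le (by linarith)
  gcongr
  exact rpow_neg_pi_mul_sq_le hn hη

theorem exists_norm_integral_saddleKernel_sq_le_of_lt :
    ∃ C : ℝ, 0 < C ∧ ∀ η X : ℝ, 0 ≤ η → η ≤ 1 → 0 < X → 1 ≤ Real.pi * X ^ 2 → ∀ n : ℕ, X < n →
      ‖∫ y in (1 : ℝ)..Real.pi * X ^ 2, saddleKernel (Real.pi / 2) (Real.pi * (n : ℝ) ^ 2)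
          ((1 / 2 + η : ℝ) + y * Complex.I)‖
        ≤ C * ((Real.pi * X ^ 2) ^ η * (n : ℝ) ^ (-(1 + 2 * η)) * (n / (n - X))) := by
  obtain ⟨C, hC, h⟩ := exists_norm_integral_saddleKernel_le_of_lt
  refine ⟨C, hC, fun η X hη hη' hX hX1 n hnX => ?_⟩
  have hn' : (0 : ℝ) < n := by linarith
  have hn : 0 < n := by exact_mod_cast hn'
  have hpi := Real.pi_gt_three
  have hlt : Real.pi * X ^ 2 < Real.pi * (n : ℝ) ^ 2 := by gcongr
  have h1 := h η (Real.pi * (n : ℝ) ^ 2) (Real.pi * X ^ 2) hη hη' hX1 hlt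
  refine h1.trans ?_
  have h2 : Real.pi * (n : ℝ) ^ 2 / (Real.pi * (n : ℝ) ^ 2 - Real.pi * X ^ 2) ≤ n / (n - X) := by
    rw [div_le_div_iff₀ (by linarith) (by linarith)]
    have : 0 ≤ Real.pi * n * (X * (n - X)) := by
      have := sub_nonneg.mpr hnX.le
      positivity
    nlinarith
  have h3 : 0 ≤ (n : ℝ) / (n - X) := div_nonneg hn'.le (by linarith)
  gcongr
  exact rpow_neg_pi_mul_sq_le hn hη

/-- Near the saddle point the powers of `η` cancel and the kernel has size `1/n`, on a range of
length about `n`. -/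
theorem pi_mul_succ_sq_rpow_le {n : ℕ} (hn : 0 < n) {η : ℝ} (hη : 0 ≤ η) (hη' : η ≤ 1) :
    (Real.pi * ((n : ℝ) + 1) ^ 2) ^ η * (n : ℝ) ^ (-(1 + 2 * η)) ≤ 4 * Real.pi / n := by
  have hn' : (1 : ℝ) ≤ n := by exact_mod_cast hn
  have hpi := Real.pi_gt_three
  have h1 : Real.pi * ((n : ℝ) + 1) ^ 2 ≤ (4 * Real.pi) * (n : ℝ) ^ 2 := by
    have : ((n : ℝ) + 1) ^ 2 ≤ (2 * n) ^ 2 := by gcongr; linarith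
    nlinarith
  have h2 : (4 * Real.pi) ^ η ≤ 4 * Real.pi := by
    calc (4 * Real.pi) ^ η ≤ (4 * Real.pi) ^ (1 : ℝ) :=
          Real.rpow_le_rpow_of_exponent_le (by linarith) hη'
      _ = _ := Real.rpow_one _
  have h3 : ((n : ℝ) ^ 2) ^ η * (n : ℝ) ^ (-(1 + 2 * η)) = (n : ℝ)⁻¹ := by
    rw [← Real.rpow_two, ← Real.rpow_mul (by linarith), ← Real.rpow_add (by linarith),
      ← Real.rpow_neg_one]
    congr 1
    ring
  calc (Real.pi * ((n : ℝ) + 1) ^ 2) ^ η * (n : ℝ) ^ (-(1 + 2 * η))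
      ≤ ((4 * Real.pi) * (n : ℝ) ^ 2) ^ η * (n : ℝ) ^ (-(1 + 2 * η)) := by gcongr
    _ = (4 * Real.pi) ^ η * (((n : ℝ) ^ 2) ^ η * (n : ℝ) ^ (-(1 + 2 * η))) := by
        rw [Real.mul_rpow (by positivity) (by positivity)]
        ring
    _ ≤ 4 * Real.pi * (n : ℝ)⁻¹ := by rw [h3]; gcongr
    _ = _ := by rw [div_eq_mul_inv]

/-- Near the saddle point the truncated integral is bounded. -/
theorem exists_norm_integral_saddleKernel_sq_le_of_near :
    ∃ C : ℝ, 0 < C ∧ ∀ η X : ℝ, 0 ≤ η → η ≤ 1 → 0 < X → 1 ≤ Real.pi * X ^ 2 → ∀ n : ℕ, 0 < n →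
      X ≤ n + 1 → n ≤ X + 1 →
      ‖∫ y in (1 : ℝ)..Real.pi * X ^ 2, saddleKernel (Real.pi / 2) (Real.pi * (n : ℝ) ^ 2)
          ((1 / 2 + η : ℝ) + y * Complex.I)‖ ≤ C := by
  obtain ⟨C₁, hC₁, h₁⟩ := exists_norm_integral_saddleKernel_sq_sub_le
  obtain ⟨C₂, hC₂, h₂⟩ := exists_norm_saddleKernel_sq_le
  refine ⟨C₁ * (8 * Real.pi) + 2 * Real.pi + C₂ * (16 * Real.pi ^ 2), by positivity,
    fun η X hη hη' hX hX1 n hn h3 h4 => ?_⟩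
  have hn' : (1 : ℝ) ≤ n := by exact_mod_cast hn
  have hn0 : (0 : ℝ) < n := by linarith
  have hpi := Real.pi_pos
  set Y := Real.pi * X ^ 2 with hY
  -- The endpoint is pushed to `X = n + 1`, safely past the saddle point, where the evaluation has
  -- bounded error. The piece added has length at most `4πn`, from `(n+1)² - (n-1)² = 4n`, and
  -- integrand of order `1/n`.
  set Y' := Real.pi * ((n : ℝ) + 1) ^ 2 with hY'
  set F : ℝ → ℂ := fun y => saddleKernel (Real.pi / 2) (Real.pi * (n : ℝ) ^ 2)
    ((1 / 2 + η : ℝ) + y * Complex.I) with hF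
  have hcont : Continuous F := continuous_saddleKernel _ (by linarith) (by positivity)
  have hYY' : Y ≤ Y' := by rw [hY, hY']; gcongr
  have hkey := pi_mul_succ_sq_rpow_le hn hη hη'
  rw [← hY'] at hkey
  have hA : ‖(∫ y in (1 : ℝ)..Y', F y) - 2 * Real.pi * (-1) ^ n‖ ≤ C₁ * (8 * Real.pi) := by
    refine (h₁ η (n + 1) hη hη' n hn (by linarith)).trans ?_
    rw [← hY', add_sub_cancel_left, div_one]
    refine mul_le_mul_of_nonneg_left ?_ hC₁.le
    calc Y' ^ η * (n : ℝ) ^ (-(1 + 2 * η)) * (n + 1) ≤ 4 * Real.pi / n * (2 * n) := by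
          gcongr
          linarith
      _ = _ := by field_simp; ring
  have hB : ‖∫ y in Y..Y', F y‖ ≤ C₂ * (16 * Real.pi ^ 2) := by
    have h5 : ∀ y ∈ Set.uIoc Y Y', ‖F y‖ ≤ C₂ * (4 * Real.pi / n) := by
      intro y hy
      rw [Set.uIoc_of_le hYY'] at hy
      have hy1 : 1 ≤ y := by linarith [hy.1]
      refine (h₂ η hη hη' n hn y hy1).trans ?_
      rw [mul_assoc]
      gcongr
      refine le_trans ?_ hkey
      have := hy.2
      gcongr
    refine (intervalIntegral.norm_integral_le_of_norm_le_const h5).trans ?_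
    have h6 : |Y' - Y| ≤ 4 * Real.pi * n := by
      rw [abs_of_nonneg (by linarith), hY, hY']
      have h7 : ((n : ℝ) - 1) ^ 2 ≤ X ^ 2 := by
        gcongr
        linarith
      nlinarith
    calc C₂ * (4 * Real.pi / n) * |Y' - Y| ≤ C₂ * (4 * Real.pi / n) * (4 * Real.pi * n) := by
          gcongr
      _ = _ := by field_simp; ring
  have hsplit : ∫ y in (1 : ℝ)..Y, F y = ((∫ y in (1 : ℝ)..Y', F y) - 2 * Real.pi * (-1) ^ n)
      + 2 * Real.pi * (-1) ^ n - ∫ y in Y..Y', F y := by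
    rw [← intervalIntegral.integral_add_adjacent_intervals (hcont.intervalIntegrable 1 Y)
      (hcont.intervalIntegrable Y Y')]
    ring
  have hM : ‖(2 * Real.pi * (-1) ^ n : ℂ)‖ = 2 * Real.pi := by
    rw [norm_mul, norm_pow, norm_neg, norm_one, one_pow, mul_one, norm_mul, Complex.norm_ofNat,
      Complex.norm_real, Real.norm_of_nonneg hpi.le]
  rw [hsplit]
  refine (norm_sub_le _ _).trans (add_le_add ((norm_add_le _ _).trans (add_le_add hA hM.le)) hB)

/-! ### Summation over `n`. -/

theorem norm_sum_range_neg_one_pow_le (N : ℕ) :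
    ‖∑ n ∈ Finset.range N, (-1 : ℂ) ^ n‖ ≤ 1 := by
  rw [neg_one_geom_sum]
  split_ifs <;> simp

/-- The harmonic sums give a logarithm, replaced here by a small power; this is the second factor
`Y^η` in the final `Y^{2η}`. -/
theorem sum_range_one_div_add_one_div_le (N : ℕ) {δ : ℝ} (hδ : 0 < δ) :
    ∑ i ∈ Finset.range N, (1 / ((i : ℝ) + 1) + 1 / ((N : ℝ) - i))
      ≤ 2 + 2 * ((N : ℝ) + 1) ^ δ / δ := by
  have h1 : ∑ i ∈ Finset.range N, 1 / ((N : ℝ) - i) = ∑ i ∈ Finset.range N, 1 / ((i : ℝ) + 1) := by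
    rw [← Finset.sum_range_reflect]
    refine Finset.sum_congr rfl fun i hi => ?_
    have hi' := Finset.mem_range.mp hi
    rw [Nat.sub_sub, Nat.cast_sub (by omega)]
    push_cast
    congr 1
    ring
  have h2 : ∑ i ∈ Finset.range N, 1 / ((i : ℝ) + 1) ≤ 1 + Real.log N := by
    have h := harmonic_le_one_add_log N
    rw [harmonic] at h
    push_cast at h
    simpa only [one_div] using h
  have h3 : Real.log N ≤ ((N : ℝ) + 1) ^ δ / δ := by
    refine le_trans ?_ (Real.log_le_rpow_div (by positivity) hδ)
    rcases Nat.eq_zero_or_pos N with rfl | hN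
    · simp
    · have : (0 : ℝ) < N := by exact_mod_cast hN
      exact Real.log_le_log this (by linarith)
  rw [Finset.sum_add_distrib, h1]
  have h4 : 2 * ((N : ℝ) + 1) ^ δ / δ = 2 * (((N : ℝ) + 1) ^ δ / δ) := by ring
  linarith

/-- The integral of the rotated zeta function to the right of the critical strip. -/
theorem exists_norm_integral_rotatedZeta_right_le {η : ℝ} (hη : 0 < η) (hη' : η ≤ 1) :
    ∃ C : ℝ, 0 < C ∧ ∀ Y : ℝ, 1 ≤ Y →
      ‖∫ y in (1 : ℝ)..Y, rotatedZeta ((1 / 2 + η : ℝ) + y * Complex.I)‖ ≤ C * Y ^ (2 * η) := by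
  obtain ⟨C₁, hC₁, h₁⟩ := exists_norm_integral_saddleKernel_sq_sub_le
  obtain ⟨C₂, hC₂, h₂⟩ := exists_norm_integral_saddleKernel_sq_le_of_lt
  obtain ⟨C₃, hC₃, h₃⟩ := exists_norm_integral_saddleKernel_sq_le_of_near
  have hsum : Summable fun j : ℕ => ((j + 1 : ℕ) : ℝ) ^ (-(1 + 2 * η)) :=
    (summable_nat_add_iff 1).mpr (Real.summable_nat_rpow.mpr (by linarith))
  set S := ∑' j : ℕ, ((j + 1 : ℕ) : ℝ) ^ (-(1 + 2 * η)) with hS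
  have hS0 : 0 ≤ S := tsum_nonneg fun j => by positivity
  have hpi := Real.pi_gt_three
  refine ⟨2 * Real.pi + 2 * Real.pi + C₁ * (2 + 2 * 2 / η) + C₃ + C₃ + C₂ * S, by positivity,
    fun Y hY => ?_⟩
  set X := √(Y / Real.pi) with hX
  have hXY : Real.pi * X ^ 2 = Y := by
    rw [hX, Real.sq_sqrt (by positivity)]
    field_simp
  have hX0 : 0 < X := Real.sqrt_pos.mpr (by positivity)
  set J : ℕ → ℂ := fun n => ∫ y in (1 : ℝ)..Y,
    saddleKernel (Real.pi / 2) (Real.pi * (n : ℝ) ^ 2) ((1 / 2 + η : ℝ) + y * Complex.I) with hJ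
  have hJsum : HasSum J (∫ y in (1 : ℝ)..Y, rotatedZeta ((1 / 2 + η : ℝ) + y * Complex.I)) :=
    hasSum_integral_saddleKernel hη hη' hY
  have hJ0 : J 0 = 0 := by
    have hκ : 0 < 1 / 2 + η := by linarith
    simp only [hJ, Nat.cast_zero, ne_eq, OfNat.ofNat_ne_zero, not_false_eq_true, zero_pow,
      mul_zero, saddleKernel_zero _ (vertical_ne_zero hκ _), intervalIntegral.integral_zero]
  set N := ⌊X⌋₊ with hN
  have hNX : (N : ℝ) ≤ X := Nat.floor_le hX0.le
  have hXN : X < N + 1 := Nat.lt_floor_add_one X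
  have hYη : 1 ≤ Y ^ η := Real.one_le_rpow hY hη.le
  have hYη0 : 0 < Y ^ η := by linarith
  have hYY : Y ^ η * Y ^ η = Y ^ (2 * η) := by
    rw [← Real.rpow_add (by linarith)]
    congr 1
    ring
  have hYle : Y ^ η ≤ Y ^ (2 * η) := by
    rw [← hYY]
    nlinarith
  have hY1 : 1 ≤ Y ^ (2 * η) := hYη.trans hYle
  have hnear : ∀ n : ℕ, X ≤ n + 1 → n ≤ X + 1 → ‖J n‖ ≤ C₃ := by
    intro n h4 h5
    rcases Nat.eq_zero_or_pos n with rfl | hn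
    · rw [hJ0, norm_zero]
      exact hC₃.le
    · have := h₃ η X hη.le hη' hX0 (by rw [hXY]; exact hY) n hn h4 h5
      rwa [hXY] at this
  -- One factor `n` cancels against the saddle denominator: `n^{-1-2η} n/(n-X) = n^{-2η}/(n-X)`, and
  -- both `n` and `n - X` are at least `j + 1`.
  have hfar : ∀ j : ℕ, ‖J (j + (N + 2))‖
      ≤ C₂ * Y ^ η * ((j + 1 : ℕ) : ℝ) ^ (-(1 + 2 * η)) := by
    intro j
    set n := j + (N + 2) with hn
    have hnc : (n : ℝ) = j + N + 2 := by rw [hn]; push_cast; ring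
    have hj : (0 : ℝ) ≤ j := j.cast_nonneg
    have hn0 : (0 : ℝ) < n := by rw [hnc]; positivity
    have hlt : X < n := by rw [hnc]; linarith
    have h4 := h₂ η X hη.le hη' hX0 (by rw [hXY]; exact hY) n hlt
    rw [hXY] at h4
    refine h4.trans ?_
    rw [mul_assoc C₂, mul_assoc (Y ^ η)]
    gcongr
    have h5 : (n : ℝ) ^ (-(1 + 2 * η)) * n = (n : ℝ) ^ (-(2 * η)) := by
      rw [← Real.rpow_add_one hn0.ne']
      congr 1
      ring
    have h6 : ((j + 1 : ℕ) : ℝ) ^ (-(1 + 2 * η))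
        = ((j + 1 : ℕ) : ℝ) ^ (-(2 * η)) / ((j + 1 : ℕ) : ℝ) := by
      rw [← Real.rpow_sub_one (by positivity)]
      congr 1
      ring
    rw [← mul_div_assoc, h5, h6]
    have h7 : ((j + 1 : ℕ) : ℝ) ≤ n - X := by rw [hnc]; push_cast; linarith
    have h8 : ((j + 1 : ℕ) : ℝ) ≤ n := by linarith
    have h9 : (n : ℝ) ^ (-(2 * η)) ≤ ((j + 1 : ℕ) : ℝ) ^ (-(2 * η)) :=
      Real.rpow_le_rpow_of_nonpos (by positivity) h8 (by linarith)
    gcongr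
  have htail : ‖∑' j : ℕ, J (j + (N + 2))‖ ≤ C₂ * Y ^ η * S :=
    tsum_of_norm_bounded (hsum.hasSum.mul_left _) hfar
  -- With `m = i + 1`, the partial fractions `X/(m(X-m)) = 1/m + 1/(X-m)` reduce the error to two
  -- harmonic sums.
  have hterm : ∀ i : ℕ, i + 1 < N →
      ‖J (i + 1) - 2 * Real.pi * (-1) ^ (i + 1)‖
        ≤ C₁ * Y ^ η * (1 / ((i : ℝ) + 1) + 1 / (((N - 1 : ℕ) : ℝ) - i)) := by
    intro i hi
    have hi' : (i : ℝ) + 1 + 1 ≤ N := by exact_mod_cast hi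
    have hi0 : (0 : ℝ) ≤ i := i.cast_nonneg
    have h4 := h₁ η X hη.le hη' (i + 1) i.succ_pos (by push_cast; linarith)
    rw [hXY] at h4
    refine h4.trans ?_
    rw [mul_assoc C₁, mul_assoc (Y ^ η)]
    push_cast [Nat.cast_sub (show 1 ≤ N by omega)]
    gcongr
    set m : ℝ := (i : ℝ) + 1 with hm
    have hm0 : 1 ≤ m := by linarith
    have hXm : 0 < X - m := by linarith
    have h5 : m ^ (-(1 + 2 * η)) ≤ m⁻¹ := by
      rw [← Real.rpow_neg_one]
      exact Real.rpow_le_rpow_of_exponent_le hm0 (by linarith)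
    calc m ^ (-(1 + 2 * η)) * (X / (X - m)) ≤ m⁻¹ * (X / (X - m)) := by gcongr
      _ = 1 / m + 1 / (X - m) := by field_simp; ring
      _ ≤ 1 / m + 1 / (N - 1 - i) :=
          add_le_add le_rfl (one_div_le_one_div_of_le (by linarith) (by linarith))
  have hhead : ‖∑ n ∈ Finset.range N, J n‖
      ≤ 2 * Real.pi + 2 * Real.pi + C₁ * (2 + 2 * 2 / η) * Y ^ (2 * η) := by
    have hM : ∀ c : ℂ, ‖(2 * Real.pi : ℂ) * c‖ = 2 * Real.pi * ‖c‖ := fun c => by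
      rw [norm_mul, norm_mul, Complex.norm_ofNat, Complex.norm_real,
        Real.norm_of_nonneg Real.pi_pos.le]
    have hsplit : ∑ n ∈ Finset.range N, J n = 2 * Real.pi * ∑ n ∈ Finset.range N, (-1 : ℂ) ^ n
        + ∑ n ∈ Finset.range N, (J n - 2 * Real.pi * (-1) ^ n) := by
      rw [Finset.sum_sub_distrib, Finset.mul_sum]
      ring
    have hmain : ‖2 * Real.pi * ∑ n ∈ Finset.range N, (-1 : ℂ) ^ n‖ ≤ 2 * Real.pi := by
      rw [hM]
      have := norm_sum_range_neg_one_pow_le N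
      nlinarith
    have herr : ‖∑ n ∈ Finset.range N, (J n - 2 * Real.pi * (-1) ^ n)‖
        ≤ 2 * Real.pi + C₁ * (2 + 2 * 2 / η) * Y ^ (2 * η) := by
      have hpos : 0 ≤ C₁ * (2 + 2 * 2 / η) * Y ^ (2 * η) := by positivity
      rcases Nat.eq_zero_or_pos N with h0 | h0
      · rw [h0, Finset.range_zero, Finset.sum_empty, norm_zero]
        positivity
      obtain ⟨M, hM'⟩ : ∃ M, N = M + 1 := ⟨N - 1, by omega⟩
      have hN1 : N - 1 = M := by omega
      -- The alternating sum includes `n = 0` although `J 0 = 0`; the discrepancy is a single `2π`.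
      rw [hM', Finset.sum_range_succ', hJ0, pow_zero, mul_one, zero_sub]
      refine (norm_add_le _ _).trans ?_
      have hlast : ‖-(2 * Real.pi : ℂ)‖ = 2 * Real.pi := by
        have := hM 1
        rwa [mul_one, norm_one, mul_one, ← norm_neg] at this
      rw [hlast]
      have hfirst : ‖∑ i ∈ Finset.range M, (J (i + 1) - 2 * Real.pi * (-1) ^ (i + 1))‖
          ≤ C₁ * Y ^ η * (2 + 2 * ((M : ℝ) + 1) ^ η / η) := by
        refine (norm_sum_le_of_le _ fun i hi => ?_).trans
          (?_ : ∑ i ∈ Finset.range M, C₁ * Y ^ η * (1 / ((i : ℝ) + 1) + 1 / ((M : ℝ) - i)) ≤ _)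
        · have := hterm i (by have := Finset.mem_range.mp hi; omega)
          rwa [hN1] at this
        · rw [← Finset.mul_sum]
          gcongr
          exact sum_range_one_div_add_one_div_le M hη
      have hMY : ((M : ℝ) + 1) ^ η ≤ 2 * Y ^ η := by
        have h5 : (M : ℝ) + 1 ≤ X := by
          have : (N : ℝ) = M + 1 := by rw [hM']; push_cast; ring
          linarith
        have h6 : X ≤ Y := by
          have h7 : 1 ≤ X := by
            have : (0 : ℝ) ≤ M := M.cast_nonneg
            linarith
          nlinarith
        have h8 : ((M : ℝ) + 1) ^ η ≤ Y ^ η := by gcongr; linarith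
        linarith
      have h9 : C₁ * Y ^ η * (2 + 2 * ((M : ℝ) + 1) ^ η / η)
          ≤ C₁ * (2 + 2 * 2 / η) * Y ^ (2 * η) := by
        calc C₁ * Y ^ η * (2 + 2 * ((M : ℝ) + 1) ^ η / η)
            ≤ C₁ * Y ^ η * (2 * Y ^ η + 2 * (2 * Y ^ η) / η) := by
              gcongr
              linarith
          _ = C₁ * (2 + 2 * 2 / η) * (Y ^ η * Y ^ η) := by ring
          _ = _ := by rw [hYY]
      linarith
    rw [hsplit]
    refine (norm_add_le _ _).trans ?_
    linarith
  have hN1 := hnear N hXN.le (by linarith)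
  have hN2 := hnear (N + 1) (by push_cast; linarith) (by push_cast; linarith)
  rw [← hJsum.tsum_eq, ← hJsum.summable.sum_add_tsum_nat_add (N + 2), Finset.sum_range_succ,
    Finset.sum_range_succ]
  have hA := norm_add_le (∑ n ∈ Finset.range N, J n + J N + J (N + 1)) (∑' j : ℕ, J (j + (N + 2)))
  have hB := norm_add_le (∑ n ∈ Finset.range N, J n + J N) (J (N + 1))
  have hC := norm_add_le (∑ n ∈ Finset.range N, J n) (J N)
  have hD : C₂ * Y ^ η * S ≤ C₂ * S * Y ^ (2 * η) := by
    calc C₂ * Y ^ η * S = C₂ * S * Y ^ η := by ring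
      _ ≤ _ := by gcongr
  have hE : 2 * Real.pi + 2 * Real.pi + C₃ + C₃
      ≤ (2 * Real.pi + 2 * Real.pi + C₃ + C₃) * Y ^ (2 * η) :=
    le_mul_of_one_le_right (by positivity) hY1
  linarith

/-! ### Return to the critical line. -/

theorem rotatedZeta_differentiableAt {z : ℂ} (hz : z.im ≠ 0) :
    DifferentiableAt ℂ rotatedZeta z := by
  have h0 : 2 * z ≠ 0 := fun h => hz (by
    have := congrArg Complex.im h
    simpa using this)
  have h1 : 2 * z ≠ 1 := fun h => hz (by
    have := congrArg Complex.im h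
    simpa using this)
  have h2 : DifferentiableAt ℂ (fun z : ℂ => completedRiemannZeta (2 * z)) z :=
    DifferentiableAt.comp z (differentiableAt_completedZeta h0 h1)
      (differentiableAt_id.const_mul 2)
  exact h2.mul (by fun_prop)

/-- The integral of the rotated zeta function along the critical line. -/
theorem exists_norm_integral_rotatedZeta_le {η : ℝ} (hη : 0 < η) (hη' : η ≤ 1 / 2) :
    ∃ C : ℝ, 0 < C ∧ ∀ Y : ℝ, 1 ≤ Y →
      ‖∫ y in (1 : ℝ)..Y, rotatedZeta ((1 / 4 : ℝ) + y * Complex.I)‖ ≤ C * Y ^ (2 * η) := by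
  obtain ⟨C₁, hC₁, h₁⟩ := exists_norm_integral_rotatedZeta_right_le hη (by linarith)
  obtain ⟨C₂, hC₂, h₂⟩ := exists_norm_rotatedZeta_le hη hη'
  refine ⟨C₁ + 2 * C₂, by positivity, fun Y hY => ?_⟩
  have hYle : Y ^ η ≤ Y ^ (2 * η) := Real.rpow_le_rpow_of_exponent_le hY (by linarith)
  have hedge : ∀ y : ℝ, 1 ≤ y → y ≤ Y → ∀ x ∈ Set.Icc (1 / 4 : ℝ) (1 / 2 + η),
      ‖rotatedZeta (x + y * Complex.I)‖ ≤ C₂ * Y ^ (2 * η) := by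
    intro y hy hyY x hx
    have hre : ((x : ℂ) + y * Complex.I).re = x := by simp
    have him : ((x : ℂ) + y * Complex.I).im = y := by simp
    have h := h₂ (x + y * Complex.I) (by rw [hre]; linarith [hx.1]) (by rw [hre]; exact hx.2)
      (by rwa [him])
    rw [him] at h
    refine h.trans ?_
    gcongr
    refine le_trans ?_ hYle
    gcongr
  have hrect := norm_integral_vertical_sub_le (g := rotatedZeta) (x₁ := 1 / 4) (x₂ := 1 / 2 + η)
    (by linarith) hY (fun z _ hz => rotatedZeta_differentiableAt (by linarith [hz.1]))
    (hedge 1 le_rfl hY) (hedge Y hY le_rfl)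
  have h3 := h₁ Y hY
  set A := ∫ y in (1 : ℝ)..Y, rotatedZeta ((1 / 2 + η : ℝ) + y * Complex.I)
  set B := ∫ y in (1 : ℝ)..Y, rotatedZeta ((1 / 4 : ℝ) + y * Complex.I)
  have h4 := norm_sub_le A (A - B)
  rw [sub_sub_cancel] at h4
  have h5 : (1 / 2 + η - 1 / 4) * (C₂ * Y ^ (2 * η) + C₂ * Y ^ (2 * η))
      ≤ 1 * (C₂ * Y ^ (2 * η) + C₂ * Y ^ (2 * η)) := by
    gcongr
    linarith
  linarith

/-! ### Monotone weights and Hardy's function. -/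

/-- Partial integration bound for a weight of bounded variation. -/
theorem norm_integral_mul_le {M : ℝ → ℝ} {b : ℝ → ℂ} {p q K V : ℝ} (hpq : p ≤ q)
    (hM : ContDiff ℝ 1 M) (hb : Continuous b) (hK : ∀ y ∈ Set.Icc p q, ‖∫ t in p..y, b t‖ ≤ K)
    (hV : ∫ y in p..q, |deriv M y| ≤ V) :
    ‖∫ y in p..q, (M y : ℂ) * b y‖ ≤ (|M q| + V) * K := by
  have hK0 : 0 ≤ K := (norm_nonneg _).trans (hK p (Set.left_mem_Icc.mpr hpq))
  have hM' : Continuous (deriv M) := hM.continuous_deriv le_rfl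
  have hparts := intervalIntegral.integral_mul_deriv_eq_deriv_mul (a := p) (b := q)
    (u := fun y => (M y : ℂ)) (u' := fun y => ((deriv M y : ℝ) : ℂ))
    (v := fun y => ∫ t in p..y, b t) (v' := b)
    (fun y _ => ((hM.differentiable one_ne_zero) y).hasDerivAt.ofReal_comp)
    (fun y _ => intervalIntegral.integral_hasDerivAt_right (hb.intervalIntegrable _ _)
      (hb.stronglyMeasurableAtFilter _ _) hb.continuousAt)
    ((Complex.continuous_ofReal.comp hM').intervalIntegrable _ _) (hb.intervalIntegrable _ _)
  rw [hparts, intervalIntegral.integral_same, mul_zero, sub_zero]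
  have h1 : ‖(M q : ℂ) * ∫ t in p..q, b t‖ ≤ |M q| * K := by
    rw [norm_mul, Complex.norm_real, Real.norm_eq_abs]
    gcongr
    exact hK q (Set.right_mem_Icc.mpr hpq)
  have h2 : ‖∫ y in p..q, ((deriv M y : ℝ) : ℂ) * ∫ t in p..y, b t‖ ≤ V * K := by
    refine (intervalIntegral.norm_integral_le_of_norm_le (g := fun y => |deriv M y| * K) hpq
      (Filter.Eventually.of_forall fun y hy => ?_)
      ((hM'.abs.mul continuous_const).intervalIntegrable _ _)).trans ?_
    · rw [norm_mul, Complex.norm_real, Real.norm_eq_abs]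
      gcongr
      exact hK y ⟨hy.1.le, hy.2⟩
    · rw [intervalIntegral.integral_mul_const]
      gcongr
  refine (norm_sub_le _ _).trans ?_
  rw [add_mul]
  exact add_le_add h1 h2

theorem integral_abs_deriv_of_monotoneOn {M : ℝ → ℝ} {p q : ℝ} (hp : 0 < p) (hpq : p ≤ q)
    (hM : ContDiff ℝ 1 M) (hmono : MonotoneOn M (Set.Ici 0)) :
    ∫ y in p..q, |deriv M y| = M q - M p := by
  have hM' : Continuous (deriv M) := hM.continuous_deriv le_rfl
  rw [← intervalIntegral.integral_deriv_eq_sub (fun y _ => (hM.differentiable one_ne_zero) y)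
    (hM'.intervalIntegrable _ _)]
  refine intervalIntegral.integral_congr fun y hy => ?_
  rw [Set.uIcc_of_le hpq] at hy
  have h := hmono.derivWithin_nonneg (x := y)
  rw [derivWithin_of_mem_nhds (Ici_mem_nhds (by linarith [hy.1]))] at h
  exact abs_of_nonneg h

theorem integral_abs_deriv_of_antitoneOn {M : ℝ → ℝ} {p q : ℝ} (hp : 0 < p) (hpq : p ≤ q)
    (hM : ContDiff ℝ 1 M) (hanti : AntitoneOn M (Set.Ici 0)) :
    ∫ y in p..q, |deriv M y| = M p - M q := by
  have h := integral_abs_deriv_of_monotoneOn (M := fun y => -M y) hp hpq hM.neg hanti.neg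
  simp only [deriv.fun_neg, abs_neg] at h
  rw [h]
  ring

/-- The weight `e^{-πy/2} / |Γ(1/2+iy)|`. -/
noncomputable def gammaHalfWeight (y : ℝ) : ℝ :=
  Real.exp (-(Real.pi / 2 * y)) / ‖Complex.Gamma ((1 / 2 : ℝ) + y * Complex.I)‖

/-- The ratio `|Γ(1/2+iy)| / |Γ(1/4+iy)|`. -/
noncomputable def gammaRatio (y : ℝ) : ℝ :=
  ‖Complex.Gamma ((1 / 2 : ℝ) + y * Complex.I)‖ / ‖Complex.Gamma ((1 / 4 : ℝ) + y * Complex.I)‖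

theorem norm_Gamma_vertical_ne_zero {x : ℝ} (hx : 0 < x) (y : ℝ) :
    ‖Complex.Gamma (x + y * Complex.I)‖ ≠ 0 :=
  norm_ne_zero_iff.mpr (Complex.Gamma_ne_zero_of_re_pos (by simpa using hx))

theorem contDiff_gammaHalfWeight : ContDiff ℝ 1 gammaHalfWeight :=
  ContDiff.div (by fun_prop) (contDiff_norm_Gamma (by norm_num))
    fun y => norm_Gamma_vertical_ne_zero (by norm_num) y

theorem contDiff_gammaRatio : ContDiff ℝ 1 gammaRatio :=
  ContDiff.div (contDiff_norm_Gamma (by norm_num)) (contDiff_norm_Gamma (by norm_num))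
    fun y => norm_Gamma_vertical_ne_zero (by norm_num) y

theorem gammaHalfWeight_sq (y : ℝ) :
    gammaHalfWeight y ^ 2 = (1 + Real.exp (-(2 * Real.pi * y))) / (2 * Real.pi) := by
  rw [gammaHalfWeight, div_pow, norm_Gamma_half_sq, ← Real.exp_nat_mul, Real.cosh_eq]
  have h1 : (((2 : ℕ) : ℝ) * -(Real.pi / 2 * y)) = -(Real.pi * y) := by push_cast; ring
  have h2 : Real.exp (-(2 * Real.pi * y))
      = Real.exp (-(Real.pi * y)) * Real.exp (-(Real.pi * y)) := by
    rw [← Real.exp_add]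
    congr 1
    ring
  have h3 : Real.exp (-(Real.pi * y)) * Real.exp (Real.pi * y) = 1 := by
    rw [← Real.exp_add, neg_add_cancel, Real.exp_zero]
  have hpi := Real.pi_ne_zero
  rw [h1, h2, div_div_eq_mul_div]
  field_simp
  linear_combination h3

/-- The exact value of `|Γ(1/2+iy)|` turns the squared weight into a constant plus a decreasing
exponential. -/
theorem antitoneOn_gammaHalfWeight : AntitoneOn gammaHalfWeight (Set.Ici 0) := by
  intro u _ v _ huv
  refine le_of_sq_le_sq ?_ (by unfold gammaHalfWeight; positivity)
  rw [gammaHalfWeight_sq, gammaHalfWeight_sq]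
  have := Real.pi_pos
  gcongr

theorem continuous_rotatedZeta_quarter :
    Continuous fun y : ℝ => rotatedZeta ((1 / 4 : ℝ) + y * Complex.I) := by
  have h1 : Continuous fun y : ℝ => completedRiemannZeta (2 * ((1 / 4 : ℝ) + y * Complex.I)) := by
    refine continuous_iff_continuousAt.mpr fun y => ?_
    have hre : (2 * (((1 / 4 : ℝ) : ℂ) + y * Complex.I)).re = 1 / 2 := by simp; norm_num
    refine ContinuousAt.comp (f := fun y : ℝ => 2 * (((1 / 4 : ℝ) : ℂ) + y * Complex.I))
      (g := completedRiemannZeta)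
      (differentiableAt_completedZeta (fun h => ?_) (fun h => ?_)).continuousAt (by fun_prop)
    · rw [h] at hre; norm_num at hre
    · rw [h] at hre; norm_num at hre
  unfold rotatedZeta
  exact h1.mul (by fun_prop)

/-- The weight `e^{-πy/2} / |Γ(1/4+iy)|` is split through `|Γ(1/2+iy)|` because each of the two
resulting factors is visibly monotone. -/
theorem hardyZ_two_mul (y : ℝ) :
    (hardyZ (2 * y) : ℂ) = (Real.pi ^ (1 / 4 : ℝ) : ℝ) * Complex.exp (Real.pi / 8 * Complex.I)
      * ((gammaRatio y : ℂ) * ((gammaHalfWeight y : ℂ)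
        * rotatedZeta ((1 / 4 : ℝ) + y * Complex.I))) := by
  set z : ℂ := (1 / 4 : ℝ) + y * Complex.I with hz
  have hs : critPt (2 * y) = 2 * z := by
    rw [critPt, hz]
    push_cast
    ring
  have hs0 : 2 * z ≠ 0 := by
    have := critPt_ne_neg_nat (2 * y) 0
    rw [hs] at this
    simpa using this
  have hG := Gammaℝ_critPt_ne_zero (2 * y)
  rw [hs] at hG
  have hnorm : ‖Complex.Gammaℝ (2 * z)‖ = Real.pi ^ (-(1 / 4) : ℝ) * ‖Complex.Gamma z‖ := by
    rw [Complex.Gammaℝ_def, norm_mul, Complex.norm_cpow_eq_rpow_re_of_pos Real.pi_pos,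
      mul_div_cancel_left₀ z two_ne_zero, show -(2 * z) / 2 = -z by ring]
    congr 2
    simp [hz]
  have hexp : Complex.exp (-(Real.pi / 2 * z * Complex.I))
      = (Complex.exp (Real.pi / 8 * Complex.I))⁻¹ * (Real.exp (Real.pi / 2 * y) : ℝ) := by
    rw [← Complex.exp_neg, Complex.ofReal_exp, ← Complex.exp_add]
    congr 1
    rw [hz]
    push_cast
    linear_combination (-(Real.pi / 2 * y) : ℂ) * Complex.I_sq
  have hg1 : (‖Complex.Gamma z‖ : ℂ) ≠ 0 := by
    exact_mod_cast norm_Gamma_vertical_ne_zero (x := 1 / 4) (by norm_num) y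
  have hg2 : (‖Complex.Gamma ((1 / 2 : ℝ) + y * Complex.I)‖ : ℂ) ≠ 0 := by
    exact_mod_cast norm_Gamma_vertical_ne_zero (x := 1 / 2) (by norm_num) y
  have hE := Complex.exp_ne_zero (Real.pi / 8 * Complex.I)
  have hR : ((Real.exp (Real.pi / 2 * y) : ℝ) : ℂ) ≠ 0 := by exact_mod_cast (Real.exp_pos _).ne'
  have hp : ((Real.pi ^ (1 / 4 : ℝ) : ℝ) : ℂ) ≠ 0 := by
    exact_mod_cast (Real.rpow_pos_of_pos Real.pi_pos _).ne'
  rw [ofReal_hardyZ, chiInvSqrt_eq, hs, riemannZeta_def_of_ne_zero hs0, hnorm, rotatedZeta, hexp,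
    gammaRatio, gammaHalfWeight, Real.exp_neg, Real.rpow_neg Real.pi_pos.le, ← hz]
  generalize ‖Complex.Gamma ((1 / 2 : ℝ) + y * Complex.I)‖ = g at hg2 ⊢
  simp only [Complex.ofReal_mul, Complex.ofReal_div, Complex.ofReal_inv]
  field_simp

theorem exists_abs_integral_hardyZ_le {η : ℝ} (hη : 0 < η) (hη' : η ≤ 1 / 2) :
    ∃ C : ℝ, 0 < C ∧ ∀ T : ℝ, 2 ≤ T →
      |∫ t in (2 : ℝ)..T, hardyZ t| ≤ C * T ^ (1 / 4 + 2 * η) := by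
  obtain ⟨C₁, hC₁, h₁⟩ := exists_norm_integral_rotatedZeta_le hη hη'
  obtain ⟨C₂, hC₂, h₂⟩ := exists_norm_Gamma_half_div_le
  set w := gammaHalfWeight 1 with hw
  have hw0 : 0 < w := by
    have := norm_Gamma_vertical_ne_zero (x := 1 / 2) (by norm_num) 1
    rw [hw, gammaHalfWeight]
    positivity
  have hpos : ∀ y, 0 ≤ gammaHalfWeight y := fun y => by unfold gammaHalfWeight; positivity
  have hpos' : ∀ y, 0 ≤ gammaRatio y := fun y => by unfold gammaRatio; positivity
  set c := Real.pi ^ (1 / 4 : ℝ) with hc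
  have hc0 : 0 < c := Real.rpow_pos_of_pos Real.pi_pos _
  refine ⟨2 * (c * (2 * C₂ * (w * C₁))), by positivity, fun T hT => ?_⟩
  set Y := T / 2 with hY
  have hY1 : 1 ≤ Y := by linarith
  set b : ℝ → ℂ := fun y => rotatedZeta ((1 / 4 : ℝ) + y * Complex.I) with hb
  have hbc : Continuous b := continuous_rotatedZeta_quarter
  -- For a decreasing weight the end value plus the variation telescopes to the initial value, here
  -- `w`.
  have hstep1 : ∀ y ∈ Set.Icc 1 Y, ‖∫ t in (1 : ℝ)..y, (gammaHalfWeight t : ℂ) * b t‖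
      ≤ w * (C₁ * Y ^ (2 * η)) := by
    intro y hy
    have h := norm_integral_mul_le hy.1 contDiff_gammaHalfWeight hbc
      (K := C₁ * Y ^ (2 * η)) (fun u hu => (h₁ u hu.1).trans (by
        have := hu.1
        have := hu.2.trans hy.2
        gcongr))
      (integral_abs_deriv_of_antitoneOn one_pos hy.1 contDiff_gammaHalfWeight
        antitoneOn_gammaHalfWeight).le
    rwa [abs_of_nonneg (hpos y), add_sub_cancel] at h
  have hstep2 := norm_integral_mul_le hY1 contDiff_gammaRatio
    ((Complex.continuous_ofReal.comp contDiff_gammaHalfWeight.continuous).mul hbc) hstep1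
    (integral_abs_deriv_of_monotoneOn one_pos hY1 contDiff_gammaRatio
      (monotoneOn_norm_Gamma_div_norm_Gamma (by norm_num) (by norm_num))).le
  have hsub : ∫ t in (2 : ℝ)..T, hardyZ t = 2 * ∫ y in (1 : ℝ)..Y, hardyZ (2 * y) := by
    have h := intervalIntegral.smul_integral_comp_mul_left (a := 1) (b := Y) hardyZ 2
    rw [smul_eq_mul, mul_one, show 2 * Y = T by rw [hY]; ring] at h
    exact h.symm
  have hcomplex : ((∫ y in (1 : ℝ)..Y, hardyZ (2 * y) : ℝ) : ℂ)
      = (c : ℂ) * Complex.exp (Real.pi / 8 * Complex.I)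
        * ∫ y in (1 : ℝ)..Y, (gammaRatio y : ℂ) * ((gammaHalfWeight y : ℂ) * b y) := by
    rw [← intervalIntegral.integral_ofReal, ← intervalIntegral.integral_const_mul]
    exact intervalIntegral.integral_congr fun y _ => hardyZ_two_mul y
  have hE : ‖Complex.exp (Real.pi / 8 * Complex.I)‖ = 1 := by
    have := Complex.norm_exp_ofReal_mul_I (Real.pi / 8)
    push_cast at this
    exact this
  have hR : gammaRatio Y ≤ C₂ * Y ^ (1 / 4 : ℝ) := h₂ Y hY1
  have hK : 0 ≤ w * (C₁ * Y ^ (2 * η)) := by positivity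
  rw [hsub, abs_mul, abs_two, ← Real.norm_eq_abs, ← Complex.norm_real, hcomplex, norm_mul,
    norm_mul, hE, mul_one, Complex.norm_real, Real.norm_of_nonneg hc0.le]
  have hint : ‖∫ y in (1 : ℝ)..Y, (gammaRatio y : ℂ) * ((gammaHalfWeight y : ℂ) * b y)‖
      ≤ 2 * C₂ * (w * C₁) * T ^ (1 / 4 + 2 * η) := by
    refine hstep2.trans ?_
    rw [abs_of_nonneg (hpos' Y)]
    calc (gammaRatio Y + (gammaRatio Y - gammaRatio 1)) * (w * (C₁ * Y ^ (2 * η)))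
        ≤ (2 * (C₂ * Y ^ (1 / 4 : ℝ))) * (w * (C₁ * Y ^ (2 * η))) := by
          gcongr
          linarith [hpos' 1]
      _ = 2 * C₂ * (w * C₁) * (Y ^ (1 / 4 : ℝ) * Y ^ (2 * η)) := by ring
      _ = 2 * C₂ * (w * C₁) * Y ^ (1 / 4 + 2 * η) := by rw [← Real.rpow_add (by linarith)]
      _ ≤ 2 * C₂ * (w * C₁) * T ^ (1 / 4 + 2 * η) := by
          gcongr
          linarith
  calc 2 * (c * ‖∫ y in (1 : ℝ)..Y, (gammaRatio y : ℂ) * ((gammaHalfWeight y : ℂ) * b y)‖)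
      ≤ 2 * (c * (2 * C₂ * (w * C₁) * T ^ (1 / 4 + 2 * η))) := by gcongr
    _ = _ := by ring

theorem mainTheorem1 (ε : ℝ) (hε : 0 < ε) :
    (fun T : ℝ => ∫ t in (0 : ℝ)..T, hardyZ t) =O[Filter.atTop]
      (fun T : ℝ => T ^ ((1 : ℝ) / 4 + ε)) := by
  -- The loss is `T^{2η}`, hence `ε / 2`; the cap `1 / 2` is the range of `η` in the preceding
  -- estimates.
  have hη : 0 < min (ε / 2) (1 / 2) := lt_min (by linarith) (by norm_num)
  obtain ⟨C, hC, h⟩ := exists_abs_integral_hardyZ_le hη (min_le_right _ _)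
  refine Asymptotics.IsBigO.of_bound (|∫ t in (0 : ℝ)..2, hardyZ t| + C) ?_
  filter_upwards [Filter.eventually_ge_atTop 2] with T hT
  have hT1 : 1 ≤ T := by linarith
  have hexp : T ^ (1 / 4 + 2 * min (ε / 2) (1 / 2)) ≤ T ^ (1 / 4 + ε) :=
    Real.rpow_le_rpow_of_exponent_le hT1 (by linarith [min_le_left (ε / 2) (1 / 2)])
  have hone : 1 ≤ T ^ (1 / 4 + ε) := Real.one_le_rpow hT1 (by linarith)
  rw [Real.norm_eq_abs, Real.norm_eq_abs, abs_of_pos (show 0 < T ^ (1 / 4 + ε) by linarith),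
    ← intervalIntegral.integral_add_adjacent_intervals (continuous_hardyZ.intervalIntegrable 0 2)
      (continuous_hardyZ.intervalIntegrable 2 T)]
  refine (abs_add_le _ _).trans ?_
  rw [add_mul]
  refine add_le_add (le_mul_of_one_le_right (abs_nonneg _) hone) ((h T hT).trans ?_)
  gcongr
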